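/- Let $I\subseteq\mathbb R$ be an interval (bounded or not, with or without its end points) and let $\rho\ge 0$ be a continuous probability density on $I$ that has moments of every order and for which the polynomials are dense in $L^2(I,\rho)$. Write $\langle f,g\rangle_\rho=\int_I f(t)g(t)\rho(t)\,dt$, $c_1=\int_I t\rho(t)\,dt$ and $S_\rho(z)=\int_I\frac{\rho(t)\,dt}{z-t}$ for $z\in\mathbb C\setminus\mathbb R$, and similarly for other densities. Let $\mu\ge0$ be a density on $I$ of a secondary measure of $\rho$, that is, $\mu$ is measurable, has moments of every order, and $$S_\mu(z)=z-c_1-\frac1{S_\rho(z)}\qquad(z\in\mathbb C\setminus\mathbb R).$$ Let $T_\rho:L^2(I,\rho)\to L^2(I,\mu)$ be the continuous linear extension of the operator $$p\mapsto\Big(x\mapsto\int_I\frac{p(t)-p(x)}{t-x}\,\rho(t)\,dt\Big)$$ defined on polynomials $p$. Suppose that $\rho$ is reducible: the limit $$\varphi(x)=\lim_{\varepsilon\to0^+}2\int_I\frac{(x-t)\rho(t)\,dt}{(x-t)^2+\varepsilon^2}$$ (the reducer of $\rho$) exists for almost every $x\in I$ and also in the norm of $L^2(I,\rho)$, and $\rho/\mu$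 belongs to the image of $T_\rho$. Let $(P_n)_{n\ge0}$ be polynomials with $\deg P_n=n$ that are orthonormal for $\langle\cdot,\cdot\rangle_\rho$, let $Q_n(x)=\int_I\frac{P_n(t)-P_n(x)}{t-x}\rho(t)\,dt$ be the secondary polynomials, and put $C_n(f)=\langle f,P_n\rangle_\rho$ for $f\in L^2(I,\rho)$. Then: 1. For every $n\ge0$, $$C_n(\varphi)=\langle T_\rho(\varphi),Q_n\rangle_\mu=\Big\langle\frac{\rho}{\mu},Q_n\Big\rangle_\mu=\langle Q_n,1\rangle_\rho .$$ 2. For every $f\in L^2(I,\rho)$ of class $C^1$ on $I$, $$\int_I\Big(\int_I\frac{f(y)-f(x)}{y-x}\,\rho(y)\,dy\Big)\rho(x)\,dx=\sum_{n=1}^{\infty}C_n(\varphi)\,C_n(f),$$ where the inner integral converges absolutely for every $x\in I$, the outer integral converges absolutely, and the series converges absolutely. -/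

import Mathlib

open MeasureTheory Filter Topology Polynomial
open scoped ENNReal

namespace SecondaryMeasure

/-- The measure `ρ(t) dt` on `I`. -/
noncomputable def densityMeasure (I : Set ℝ) (ρ : ℝ → ℝ) : Measure ℝ :=
  (volume.restrict I).withDensity fun t => ENNReal.ofReal (ρ t)

/-- The measure `ν` has moments of every order. -/
def HasMoments (ν : Measure ℝ) : Prop :=
  ∀ n : ℕ, Integrable (fun t : ℝ => t ^ n) ν

/-- The operator creating secondary polynomials: `x ↦ ∫ (f(t) - f(x)) / (t - x) dν(t)`. The value
`0` given to the integrand at `t = x` is irrelevant for measures without atoms. -/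
noncomputable def secondary (ν : Measure ℝ) (f : ℝ → ℝ) (x : ℝ) : ℝ :=
  ∫ t, (f t - f x) / (t - x) ∂ν

/-- The Stieltjes transform `S_ν(z) = ∫ dν(t) / (z - t)`. -/
noncomputable def stieltjes (ν : Measure ℝ) (z : ℂ) : ℂ :=
  ∫ t, 1 / (z - (t : ℂ)) ∂ν

/-- `2 ∫ (x - t) / ((x - t)² + ε²) dν(t)`. -/
noncomputable def reducerApprox (ν : Measure ℝ) (ε x : ℝ) : ℝ :=
  2 * ∫ t, (x - t) / ((x - t) ^ 2 + ε ^ 2) ∂ν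

/-- The reducer `φ(x) = lim_{ε → 0+} 2 ∫ (x - t) / ((x - t)² + ε²) dν(t)`. The limit is meaningful
where it exists, which is required almost everywhere in `IsReducible`. -/
noncomputable def reducer (ν : Measure ℝ) (x : ℝ) : ℝ :=
  limUnder (𝓝[>] (0 : ℝ)) fun ε => reducerApprox ν ε x

/-- The Fourier coefficient `∫ f p dν` of `f` with respect to the polynomial `p`. -/
noncomputable def coeff (ν : Measure ℝ) (p : ℝ[X]) (f : ℝ → ℝ) : ℝ :=
  ∫ t, f t * p.eval t ∂ν

/-- `P 0, P 1, …` are orthonormal polynomials for `ν`, with `P n` of degree `n`. -/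
structure IsOrthonormalPolynomials (ν : Measure ℝ) (P : ℕ → ℝ[X]) : Prop where
  degree : ∀ n, (P n).degree = n
  orthonormal : ∀ m n, ∫ t, (P m).eval t * (P n).eval t ∂ν = if m = n then 1 else 0

/-! ### Polynomials in `L²` -/

theorem memLp_eval {ν : Measure ℝ} (h : HasMoments ν) (p : ℝ[X]) :
    MemLp (fun t => p.eval t) 2 ν := by
  induction p using Polynomial.induction_on' with
  | add p q hp hq => simpa [Pi.add_def] using hp.add hq
  | monomial n a =>
    have h1 : MemLp (fun t : ℝ => t ^ n) 2 ν := by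
      refine (memLp_two_iff_integrable_sq (by fun_prop)).2 ?_
      simpa [← pow_mul] using h (n * 2)
    simpa using h1.const_mul a

/-- A polynomial as an element of `L²(ν)`. -/
noncomputable def polyToLp (ν : Measure ℝ) (h : HasMoments ν) : ℝ[X] →ₗ[ℝ] Lp ℝ 2 ν where
  toFun p := (memLp_eval h p).toLp
  map_add' p q := by
    rw [← MemLp.toLp_add]
    exact MemLp.toLp_congr _ _ (by simp [Pi.add_def])
  map_smul' c p := by
    rw [RingHom.id_apply, ← MemLp.toLp_const_smul]
    exact MemLp.toLp_congr _ _ (by simp [Pi.smul_def])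

/-! ### Secondary functions of polynomials are polynomials -/

theorem ae_ne_densityMeasure (I : Set ℝ) (ρ : ℝ → ℝ) (x : ℝ) :
    ∀ᵐ t ∂densityMeasure I ρ, t ≠ x :=
  (withDensity_absolutelyContinuous _ _).ae_le (Measure.ae_ne _ x)

theorem exists_quotient (p : ℝ[X]) (x : ℝ) :
    ∃ q : ℝ[X], ∀ t, t ≠ x → (p.eval t - p.eval x) / (t - x) = q.eval t := by
  obtain ⟨q, hq⟩ := X_sub_C_dvd_sub_C_eval (p := p) (a := x)
  refine ⟨q, fun t ht => ?_⟩
  have := congrArg (eval t) hq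
  simp only [eval_sub, eval_C, eval_mul, eval_X] at this
  rw [this, mul_div_cancel_left₀ _ (sub_ne_zero.2 ht)]

theorem integrable_eval {ν : Measure ℝ} (h : HasMoments ν) (p : ℝ[X]) :
    Integrable (fun t => p.eval t) ν := by
  induction p using Polynomial.induction_on' with
  | add p q hp hq => simpa [Pi.add_def] using hp.add hq
  | monomial n a => simpa using (h n).const_mul a

theorem integrable_quotient {I : Set ℝ} {ρ : ℝ → ℝ} (h : HasMoments (densityMeasure I ρ))
    (p : ℝ[X]) (x : ℝ) :
    Integrable (fun t => (p.eval t - p.eval x) / (t - x)) (densityMeasure I ρ) := by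
  obtain ⟨q, hq⟩ := exists_quotient p x
  refine (integrable_eval h q).congr ?_
  filter_upwards [ae_ne_densityMeasure I ρ x] with t ht using (hq t ht).symm

theorem secondary_add {I : Set ℝ} {ρ : ℝ → ℝ} (h : HasMoments (densityMeasure I ρ))
    (p q : ℝ[X]) (x : ℝ) :
    secondary (densityMeasure I ρ) (fun t => (p + q).eval t) x =
      secondary (densityMeasure I ρ) (fun t => p.eval t) x +
        secondary (densityMeasure I ρ) (fun t => q.eval t) x := by
  unfold secondary
  rw [← integral_add (integrable_quotient h p x) (integrable_quotient h q x)]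
  congr 1
  ext t
  simp only [eval_add]
  ring

theorem secondary_smul (ν : Measure ℝ) (c : ℝ) (p : ℝ[X]) (x : ℝ) :
    secondary ν (fun t => (c • p).eval t) x = c * secondary ν (fun t => p.eval t) x := by
  unfold secondary
  rw [← integral_const_mul]
  congr 1
  ext t
  simp only [eval_smul, smul_eq_mul]
  ring

theorem exists_secondary_eq_eval {I : Set ℝ} {ρ : ℝ → ℝ} (h : HasMoments (densityMeasure I ρ))
    (p : ℝ[X]) :
    ∃ q : ℝ[X], ∀ x, secondary (densityMeasure I ρ) (fun t => p.eval t) x = q.eval x := by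
  induction p using Polynomial.induction_on' with
  | add p q hp hq =>
    obtain ⟨p', hp'⟩ := hp
    obtain ⟨q', hq'⟩ := hq
    exact ⟨p' + q', fun x => by rw [secondary_add h, hp', hq', eval_add]⟩
  | monomial n a =>
    refine ⟨∑ i ∈ Finset.range n,
      C (a * ∫ t, t ^ i ∂densityMeasure I ρ) * X ^ (n - 1 - i), fun x => ?_⟩
    have h1 : secondary (densityMeasure I ρ) (fun t => (monomial n a).eval t) x =
        ∫ t, ∑ i ∈ Finset.range n, (a * x ^ (n - 1 - i)) * t ^ i ∂densityMeasure I ρ := by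
      refine integral_congr_ae ?_
      filter_upwards [ae_ne_densityMeasure I ρ x] with t ht
      have h2 := (Commute.all t x).geom_sum₂_mul n
      rw [div_eq_iff (sub_ne_zero.2 ht), eval_monomial, eval_monomial, ← mul_sub, ← h2,
        ← mul_assoc, Finset.mul_sum]
      congr 1
      exact Finset.sum_congr rfl fun i _ => by ring
    rw [h1, integral_finsetSum _ fun i _ => (h i).const_mul _, eval_finsetSum]
    refine Finset.sum_congr rfl fun i _ => ?_
    rw [integral_const_mul]
    simp only [eval_mul, eval_C, eval_pow, eval_X]
    ring

theorem memLp_secondary {I : Set ℝ} {ρ μ : ℝ → ℝ} (hρ : HasMoments (densityMeasure I ρ))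
    (hμ : HasMoments (densityMeasure I μ)) (p : ℝ[X]) :
    MemLp (secondary (densityMeasure I ρ) fun t => p.eval t) 2 (densityMeasure I μ) := by
  obtain ⟨q, hq⟩ := exists_secondary_eq_eval hρ p
  rw [show (secondary (densityMeasure I ρ) fun t => p.eval t) = fun x => q.eval x from funext hq]
  exact memLp_eval hμ q

/-! ### The operator `T_ρ` -/

/-- The operator creating secondary polynomials, from polynomials to `L²(I, μ)`. -/
noncomputable def secondaryOnPoly (I : Set ℝ) (ρ μ : ℝ → ℝ)
    (hρ : HasMoments (densityMeasure I ρ)) (hμ : HasMoments (densityMeasure I μ)) :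
    ℝ[X] →ₗ[ℝ] Lp ℝ 2 (densityMeasure I μ) where
  toFun p := (memLp_secondary hρ hμ p).toLp
  map_add' p q := by
    rw [← MemLp.toLp_add]
    exact MemLp.toLp_congr _ _ (.of_forall fun x => secondary_add hρ p q x)
  map_smul' c p := by
    rw [RingHom.id_apply, ← MemLp.toLp_const_smul]
    exact MemLp.toLp_congr _ _ (.of_forall fun x => secondary_smul _ c p x)

/-- `T_ρ : L²(I, ρ) → L²(I, μ)`, the extension by continuity of the operator creating secondary
polynomials from the polynomials to `L²(I, ρ)`. -/
noncomputable def secondaryOperator (I : Set ℝ) (ρ μ : ℝ → ℝ)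
    (hρ : HasMoments (densityMeasure I ρ)) (hμ : HasMoments (densityMeasure I μ)) :
    Lp ℝ 2 (densityMeasure I ρ) →L[ℝ] Lp ℝ 2 (densityMeasure I μ) :=
  (secondaryOnPoly I ρ μ hρ hμ).extendOfNorm (polyToLp (densityMeasure I ρ) hρ)

/-! ### Standing assumptions -/

/-- `ρ` is a continuous probability density on the interval `I` (bounded or not, with or without its
end points), it has moments of every order, and the polynomials are dense in `L²(I, ρ)`. -/
structure IsAdmissibleDensity (I : Set ℝ) (ρ : ℝ → ℝ) : Prop where
  ordConnected : I.OrdConnected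
  continuousOn : ContinuousOn ρ I
  nonneg : ∀ t ∈ I, 0 ≤ ρ t
  isProbabilityMeasure : IsProbabilityMeasure (densityMeasure I ρ)
  moments : HasMoments (densityMeasure I ρ)
  dense : DenseRange (polyToLp (densityMeasure I ρ) moments)

/-- `μ` is the density on `I` of a secondary measure of `ρ`: a positive density with moments of every
order, and `S_μ(z) = z - c₁ - 1 / S_ρ(z)` off the real line, where `c₁ = ∫ t ρ(t) dt`. -/
structure IsSecondaryDensity (I : Set ℝ) (ρ μ : ℝ → ℝ) : Prop where
  aemeasurable : AEMeasurable μ (volume.restrict I)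
  nonneg : ∀ t ∈ I, 0 ≤ μ t
  moments : HasMoments (densityMeasure I μ)
  stieltjes_eq : ∀ z : ℂ, z.im ≠ 0 →
    stieltjes (densityMeasure I μ) z =
      z - ((∫ t, t ∂densityMeasure I ρ : ℝ) : ℂ) - 1 / stieltjes (densityMeasure I ρ) z

/-- The measure of density `ρ` is reducible: the limit defining its reducer exists almost everywhere
on `I` and also in the norm of `L²(I, ρ)`, and `ρ / μ` is in the image of `T_ρ`. -/
structure IsReducible (I : Set ℝ) (ρ μ : ℝ → ℝ)
    (hρ : HasMoments (densityMeasure I ρ)) (hμ : HasMoments (densityMeasure I μ)) : Prop where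
  exists_lim : ∀ᵐ x ∂volume.restrict I, ∃ l : ℝ,
    Tendsto (fun ε => reducerApprox (densityMeasure I ρ) ε x) (𝓝[>] 0) (𝓝 l)
  memLp : MemLp (reducer (densityMeasure I ρ)) 2 (densityMeasure I ρ)
  tendsto : Tendsto (fun ε => eLpNorm
      (fun x => reducerApprox (densityMeasure I ρ) ε x - reducer (densityMeasure I ρ) x) 2
      (densityMeasure I ρ)) (𝓝[>] 0) (𝓝 0)
  exists_preimage : ∃ g : Lp ℝ 2 (densityMeasure I ρ),
    ⇑(secondaryOperator I ρ μ hρ hμ g) =ᵐ[densityMeasure I μ] fun x => ρ x / μ x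

end SecondaryMeasure

open SecondaryMeasure

namespace SecondaryMeasure

/-! ### The moments of the secondary measure -/

/-! Write `T p` for the secondary polynomial of `p`. Three facts carry the proof.

The operator is an isometry up to means: `⟨Tp, Tq⟩_μ = ⟨p, q⟩_ρ - ⟨p, 1⟩_ρ ⟨q, 1⟩_ρ`
(`integral_secondary_mul_secondary`). Expanding the Stieltjes equation at infinity gives a
convolution identity between the moments of `ρ` and `μ` (`moment_relation`), which is the case `p =
X`; the general case follows by moving factors `X` from `p` to `q`. By density the formula extends
to `T_ρ f`, and for `n ≥ 1`, where `P n` has mean zero, it gives `⟨T_ρ φ, Q_n⟩_μ = C_n(φ)`.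

The kernel defining the reducer is odd, so symmetrising and letting `ε → 0` gives `∬ (h(y) - h(x)) /
(y - x) ρ ρ = ⟨h, φ⟩_ρ` whenever the quotient is integrable on the product (`integral_quotient_eq`).
With `h = P n` this is `⟨Q_n, 1⟩_ρ = C_n(φ)`.

Almost everywhere, `ρ` vanishes where `μ` does (`ae_eq_zero_of_secondary_eq_zero`), so `ρ dt = (ρ/μ)
μ dt`. Since `ρ/μ ∈ L²(μ)`, the map `f ↦ ∫ T_ρ f ρ` is a continuous functional on `L²(ρ)`; it equals
`⟨f, φ⟩_ρ` on polynomials, hence everywhere.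

For a `C¹` function `f` it remains to see that `T_ρ f` is given by the integral of difference
quotients. That quotient is not known to be integrable on the product, so both candidates are tested
against smooth `g` supported in the interior of `I`; a Leibniz rule gives them the same weak formula
(`secondary_ae_eq_secondaryOperator`). Parseval then turns `⟨φ, f⟩_ρ` into the series, whose term of
index `0` vanishes because `Q_0 = 0`. -/

theorem HasMoments.isFiniteMeasure {ν : Measure ℝ} (h : HasMoments ν) : IsFiniteMeasure ν := by
  have := h 0
  simp only [pow_zero] at this
  exact (integrable_const_iff_isFiniteMeasure one_ne_zero).1 this

/-- Once the coefficients below `k` are known to vanish, `w ^ k` factors out. The cofactor tends to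
the `k`-th coefficient as `w = -iu → 0`, but it is `O(u ^ (M + 1 - k))`. -/
theorem coeff_eq_zero_of_isBigO (G : ℂ[X]) (M : ℕ)
    (h : (fun u : ℝ => G.eval (-(u : ℂ) * Complex.I)) =O[𝓝[>] 0] fun u : ℝ => u ^ (M + 1))
    (k : ℕ) (hk : k ≤ M) : G.coeff k = 0 := by
  induction k using Nat.strong_induction_on with
  | _ k ih =>
    obtain ⟨H, rfl⟩ := X_pow_dvd_iff.2 fun d hd => ih d hd (hd.le.trans hk)
    have h0 : (X ^ k * H).coeff k = H.eval 0 := by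
      rw [coeff_X_pow_mul', if_pos le_rfl, Nat.sub_self, coeff_zero_eq_eval_zero]
    rw [h0]
    have h1 : Tendsto (fun u : ℝ => H.eval (-(u : ℂ) * Complex.I)) (𝓝[>] 0) (𝓝 (H.eval 0)) := by
      have : Continuous fun u : ℝ => H.eval (-(u : ℂ) * Complex.I) := by fun_prop
      simpa using (this.tendsto 0).mono_left nhdsWithin_le_nhds
    refine tendsto_nhds_unique h1 ?_
    obtain ⟨c, hc⟩ := h.bound
    have h2 : Tendsto (fun u : ℝ => c * u ^ (M + 1 - k)) (𝓝[>] 0) (𝓝 0) := by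
      have : Continuous fun u : ℝ => c * u ^ (M + 1 - k) := by fun_prop
      have h3 := (this.tendsto 0).mono_left (nhdsWithin_le_nhds (s := Set.Ioi 0))
      rwa [zero_pow (by omega), mul_zero] at h3
    refine squeeze_zero_norm' ?_ h2
    filter_upwards [hc, self_mem_nhdsWithin] with u hu hu0
    rw [Set.mem_Ioi] at hu0
    simp only [eval_mul, eval_pow, eval_X, norm_mul, norm_pow, norm_neg, Complex.norm_real,
      Complex.norm_I, mul_one, Real.norm_eq_abs, abs_of_pos hu0] at hu
    have h4 : u ^ (M + 1) = u ^ k * u ^ (M + 1 - k) := by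
      rw [← pow_add]
      congr 1
      omega
    rw [h4, mul_left_comm] at hu
    exact le_of_mul_le_mul_left hu (by positivity)

/-- The generating polynomial of the moments of order at most `N`. -/
noncomputable def momentPoly (ν : Measure ℝ) (N : ℕ) : ℂ[X] :=
  ∑ k ∈ Finset.range (N + 1), C ((∫ t, t ^ k ∂ν : ℝ) : ℂ) * X ^ k

theorem coeff_momentPoly (ν : Measure ℝ) {N k : ℕ} (hk : k ≤ N) :
    (momentPoly ν N).coeff k = ((∫ t, t ^ k ∂ν : ℝ) : ℂ) := by
  simp [momentPoly, coeff_C_mul, coeff_X_pow, hk]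

theorem one_le_norm_one_sub (u t : ℝ) : 1 ≤ ‖1 - -(u : ℂ) * Complex.I * t‖ := by
  have := Complex.abs_re_le_norm (1 - -(u : ℂ) * Complex.I * t)
  simpa using this

/-- The remainder of the geometric sum is `(wt) ^ (N + 1) / (1 - wt)`, and `|1 - wt| ≥ 1` because
`wt` is purely imaginary; the absolute moment of order `N + 1` then bounds the error. -/
theorem isBigO_stieltjes_sub_momentPoly {ν : Measure ℝ} (hν : HasMoments ν) (N : ℕ) :
    (fun u : ℝ => (∫ t, 1 / (1 - -(u : ℂ) * Complex.I * (t : ℂ)) ∂ν) -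
      (momentPoly ν N).eval (-(u : ℂ) * Complex.I)) =O[𝓝[>] 0] fun u : ℝ => u ^ (N + 1) := by
  have := hν.isFiniteMeasure
  refine Asymptotics.IsBigO.of_bound (∫ t, |t| ^ (N + 1) ∂ν) ?_
  filter_upwards [self_mem_nhdsWithin] with u hu
  rw [Set.mem_Ioi] at hu
  set w : ℂ := -(u : ℂ) * Complex.I with hw
  have hne : ∀ t : ℝ, 1 - w * (t : ℂ) ≠ 0 := fun t h0 => by
    have := one_le_norm_one_sub u t
    rw [← hw, h0, norm_zero] at this
    linarith
  have hi1 : Integrable (fun t : ℝ => 1 / (1 - w * (t : ℂ))) ν := by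
    refine (integrable_const (1 : ℝ)).mono' (Continuous.aestronglyMeasurable ?_) ?_
    · exact continuous_const.div (by fun_prop) hne
    · refine .of_forall fun t => ?_
      rw [norm_div, norm_one, div_le_one (norm_pos_iff.2 (hne t))]
      exact one_le_norm_one_sub u t
  have hi2 : ∀ k ∈ Finset.range (N + 1),
      Integrable (fun t : ℝ => (w * (t : ℂ)) ^ k) ν := fun k _ => by
    simpa [mul_pow] using ((hν k).ofReal (𝕜 := ℂ)).const_mul (w ^ k)
  have heval : (momentPoly ν N).eval w =
      ∫ t, ∑ k ∈ Finset.range (N + 1), (w * (t : ℂ)) ^ k ∂ν := by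
    rw [integral_finsetSum _ hi2, momentPoly, eval_finsetSum]
    refine Finset.sum_congr rfl fun k _ => ?_
    simp only [mul_pow, eval_mul, eval_C, eval_pow, eval_X]
    rw [integral_const_mul, ← integral_complex_ofReal, mul_comm]
    simp
  rw [heval, ← integral_sub hi1 (integrable_finsetSum _ hi2), Real.norm_eq_abs,
    abs_of_pos (pow_pos hu _), ← integral_mul_const]
  refine norm_integral_le_of_norm_le ?_ (.of_forall fun t => ?_)
  · refine Integrable.mul_const ?_ _
    simpa using (hν (N + 1)).norm
  · have h1 : 1 / (1 - w * (t : ℂ)) - ∑ k ∈ Finset.range (N + 1), (w * (t : ℂ)) ^ k =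
        (w * (t : ℂ)) ^ (N + 1) / (1 - w * (t : ℂ)) := by
      rw [eq_div_iff (hne t), sub_mul, div_mul_cancel₀ _ (hne t)]
      have := geom_sum_mul_neg (w * (t : ℂ)) (N + 1)
      rw [this]
      ring
    rw [h1, norm_div]
    have h2 : ‖(w * (t : ℂ)) ^ (N + 1)‖ = |t| ^ (N + 1) * u ^ (N + 1) := by
      rw [norm_pow, norm_mul, hw]
      simp [abs_of_pos hu, mul_pow, mul_comm]
    rw [h2]
    exact div_le_self (by positivity) (one_le_norm_one_sub u t)

theorem stieltjes_inv (ν : Measure ℝ) {w : ℂ} (hw : w ≠ 0) :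
    stieltjes ν (1 / w) = w * ∫ t, 1 / (1 - w * (t : ℂ)) ∂ν := by
  rw [stieltjes, ← integral_const_mul]
  congr 1
  ext t
  have : 1 / w - (t : ℂ) = (1 - w * t) / w := by field_simp
  rw [this, one_div_div, mul_one_div]

theorem tendsto_of_isBigO_pow {f : ℝ → ℂ} {g : ℝ → ℂ} {N : ℕ} {l : ℂ}
    (h : (fun u => f u - g u) =O[𝓝[>] 0] fun u : ℝ => u ^ (N + 1))
    (hg : Tendsto g (𝓝[>] 0) (𝓝 l)) : Tendsto f (𝓝[>] 0) (𝓝 l) := by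
  have h1 : Tendsto (fun u : ℝ => u ^ (N + 1)) (𝓝[>] 0) (𝓝 0) := by
    have := ((continuous_pow (M := ℝ) (N + 1)).tendsto 0).mono_left
      (nhdsWithin_le_nhds (s := Set.Ioi 0))
    simpa using this
  simpa using (h.trans_tendsto h1).add hg

/-- With `w = 1/z` and `F_ν(w) = ∫ dν(t) / (1 - wt)`, the Stieltjes equation reads `w² F_μ F_ρ = (1
- c₁ w) F_ρ - 1`. The claim compares coefficients of `w ^ (n + 2)`, letting `z = i/u` go to infinity
along the imaginary axis. -/
theorem moment_relation {I : Set ℝ} {ρ μ : ℝ → ℝ} (hρ : IsAdmissibleDensity I ρ)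
    (hμ : IsSecondaryDensity I ρ μ) (n : ℕ) :
    ∑ p ∈ Finset.HasAntidiagonal.antidiagonal n,
        (∫ t, t ^ p.1 ∂densityMeasure I μ) * ∫ t, t ^ p.2 ∂densityMeasure I ρ =
      (∫ t, t ^ (n + 2) ∂densityMeasure I ρ) -
        (∫ t, t ∂densityMeasure I ρ) * ∫ t, t ^ (n + 1) ∂densityMeasure I ρ := by
  have := hρ.isProbabilityMeasure
  set a := densityMeasure I ρ
  set b := densityMeasure I μ
  set c : ℂ := ((∫ t, t ∂a : ℝ) : ℂ) with hc
  set N := n + 2 with hN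
  let w : ℝ → ℂ := fun u => -(u : ℂ) * Complex.I
  let F : Measure ℝ → ℝ → ℂ := fun ν u => ∫ t, 1 / (1 - w u * (t : ℂ)) ∂ν
  have hev : ∀ p : ℂ[X], Tendsto (fun u => p.eval (w u)) (𝓝[>] 0) (𝓝 (p.eval 0)) := fun p => by
    have : Continuous fun u : ℝ => p.eval (-(u : ℂ) * Complex.I) := by fun_prop
    simpa [w] using (this.tendsto 0).mono_left (nhdsWithin_le_nhds (s := Set.Ioi 0))
  have hA := isBigO_stieltjes_sub_momentPoly hρ.moments N
  have hB := isBigO_stieltjes_sub_momentPoly hμ.moments N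
  have hF : Tendsto (F a) (𝓝[>] 0) (𝓝 1) := by
    have h1 := tendsto_of_isBigO_pow hA (hev _)
    have h2 : (momentPoly a N).eval 0 = 1 := by
      rw [← coeff_zero_eq_eval_zero, coeff_momentPoly _ (Nat.zero_le _)]
      simp
    rwa [h2] at h1
  have hFb : Tendsto (F b) (𝓝[>] 0) (𝓝 _) := tendsto_of_isBigO_pow hB (hev _)
  have hid : ∀ᶠ u in 𝓝[>] (0 : ℝ),
      w u ^ 2 * F b u * F a u = (1 - c * w u) * F a u - 1 := by
    -- `F a` tends to the total mass `1`, so it is eventually nonzero and the reciprocal in the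
    -- Stieltjes equation can be cleared.
    filter_upwards [hF.eventually_ne one_ne_zero, self_mem_nhdsWithin] with u hu hu0
    rw [Set.mem_Ioi] at hu0
    have hw : w u ≠ 0 := by simp [w, hu0.ne']
    have him : (1 / w u).im ≠ 0 := by
      have : 1 / w u = Complex.I * ((u⁻¹ : ℝ) : ℂ) := by
        simp only [w]
        have : (u : ℂ) ≠ 0 := by exact_mod_cast hu0.ne'
        push_cast
        field_simp
        simp
      rw [this]
      simp [hu0.ne']
    have h1 := hμ.stieltjes_eq _ him
    rw [stieltjes_inv _ hw, stieltjes_inv _ hw] at h1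
    change w u * F b u = 1 / w u - c - 1 / (w u * F a u) at h1
    have h2 : w u ^ 2 * F b u * F a u = w u * F a u * (w u * F b u) := by ring
    rw [h2, h1]
    field_simp
  set G : ℂ[X] := X ^ 2 * (momentPoly b N * momentPoly a N) -
    (momentPoly a N - C c * (X * momentPoly a N)) + 1 with hG
  have hGO : (fun u : ℝ => G.eval (-(u : ℂ) * Complex.I)) =O[𝓝[>] 0]
      fun u : ℝ => u ^ (N + 1) := by
    -- Since `F a` and `F b` satisfy the equation exactly, `G` is a combination of the two
    -- truncation errors with bounded multipliers.
    have e1 : (fun u : ℝ => G.eval (-(u : ℂ) * Complex.I)) =ᶠ[𝓝[>] 0] fun u =>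
        -(w u ^ 2 * (momentPoly a N).eval (w u)) * (F b u - (momentPoly b N).eval (w u)) +
        (-(w u ^ 2 * F b u) + (1 - c * w u)) * (F a u - (momentPoly a N).eval (w u)) := by
      filter_upwards [hid] with u hu
      simp only [hG, eval_add, eval_sub, eval_mul, eval_pow, eval_X, eval_C, eval_one]
      change _ at hu
      linear_combination hu
    refine Asymptotics.IsBigO.congr' ?_ e1.symm EventuallyEq.rfl
    have hw : Tendsto w (𝓝[>] 0) (𝓝 0) := by simpa using hev X
    have t1 := (((hw.pow 2).mul (hev (momentPoly a N))).neg).isBigO_one ℝ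
    have t2 := (((hw.pow 2).mul hFb).neg.add
      ((tendsto_const_nhds (x := (1 : ℂ))).sub (hw.const_mul c))).isBigO_one ℝ
    have t3 := (t1.mul hB).add (t2.mul hA)
    simp only [one_mul] at t3
    exact t3
  have h0 := coeff_eq_zero_of_isBigO G N hGO (n + 2) le_rfl
  have e2 : (X ^ 2 * (momentPoly b N * momentPoly a N)).coeff (n + 2) =
      ((∑ p ∈ Finset.HasAntidiagonal.antidiagonal n, (∫ t, t ^ p.1 ∂b) * ∫ t, t ^ p.2 ∂a : ℝ) : ℂ) := by
    rw [coeff_X_pow_mul, coeff_mul]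
    push_cast
    refine Finset.sum_congr rfl fun p hp => ?_
    have := Finset.HasAntidiagonal.mem_antidiagonal.1 hp
    rw [coeff_momentPoly _ (by omega), coeff_momentPoly _ (by omega)]
  have e3 : (1 : ℂ[X]).coeff (n + 2) = 0 := by simp [coeff_one]
  rw [hG, coeff_add, coeff_sub, coeff_sub, coeff_C_mul, coeff_X_mul, e2, e3,
    coeff_momentPoly _ le_rfl, coeff_momentPoly _ (by omega), hc] at h0
  have h1 : (((∑ p ∈ Finset.HasAntidiagonal.antidiagonal n, (∫ t, t ^ p.1 ∂b) * ∫ t, t ^ p.2 ∂a) : ℝ) : ℂ) =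
      (((∫ t, t ^ (n + 2) ∂a) - (∫ t, t ∂a) * ∫ t, t ^ (n + 1) ∂a : ℝ) : ℂ) := by
    push_cast at h0 ⊢
    linear_combination h0
  exact_mod_cast h1

/-! ### The isometry property on polynomials -/

/-- From `t p(t) - x p(x) = x (p(t) - p(x)) + (t - x) p(t)`. This recursion drives the inductions
below. -/
theorem secondary_X_mul {I : Set ℝ} {ρ : ℝ → ℝ} (h : HasMoments (densityMeasure I ρ))
    (p : ℝ[X]) (x : ℝ) :
    secondary (densityMeasure I ρ) (fun t => (X * p).eval t) x =
      x * secondary (densityMeasure I ρ) (fun t => p.eval t) x +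
        ∫ t, p.eval t ∂densityMeasure I ρ := by
  unfold secondary
  rw [← integral_const_mul, ← integral_add ((integrable_quotient h p x).const_mul x)
    (integrable_eval h p)]
  refine integral_congr_ae ?_
  filter_upwards [ae_ne_densityMeasure I ρ x] with t ht
  have := sub_ne_zero.2 ht
  simp only [eval_mul, eval_X]
  field_simp
  ring

theorem secondary_C (ν : Measure ℝ) (a x : ℝ) :
    secondary ν (fun t => (C a).eval t) x = 0 := by
  simp [secondary]

theorem secondary_X_pow {I : Set ℝ} {ρ : ℝ → ℝ} (h : HasMoments (densityMeasure I ρ))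
    (n : ℕ) (x : ℝ) :
    secondary (densityMeasure I ρ) (fun t => (X ^ (n + 1) : ℝ[X]).eval t) x =
      ∑ p ∈ Finset.HasAntidiagonal.antidiagonal n, x ^ p.1 * ∫ t, t ^ p.2 ∂densityMeasure I ρ := by
  induction n with
  | zero =>
    rw [show (X ^ (0 + 1) : ℝ[X]) = X * C 1 by simp, secondary_X_mul h, secondary_C]
    simp
  | succ n ih =>
    rw [pow_succ', secondary_X_mul h, ih, Finset.Nat.antidiagonal_succ, Finset.sum_cons,
      Finset.sum_map, Finset.mul_sum, add_comm]
    simp [pow_succ, mul_assoc, mul_comm]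

theorem integrable_secondary {I : Set ℝ} {ρ : ℝ → ℝ} (h : HasMoments (densityMeasure I ρ))
    {ν : Measure ℝ} (hν : HasMoments ν) (p : ℝ[X]) :
    Integrable (secondary (densityMeasure I ρ) fun t => p.eval t) ν := by
  obtain ⟨q, hq⟩ := exists_secondary_eq_eval h p
  exact (integrable_eval hν q).congr (.of_forall fun x => (hq x).symm)

/-- The isometry formula with `X` as one argument, since `T X = 1`. On the powers `X ^ (n + 1)` it
is exactly the moment relation. -/
theorem integral_secondary {I : Set ℝ} {ρ μ : ℝ → ℝ} (hρ : IsAdmissibleDensity I ρ)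
    (hμ : IsSecondaryDensity I ρ μ) (q : ℝ[X]) :
    ∫ x, secondary (densityMeasure I ρ) (fun t => q.eval t) x ∂densityMeasure I μ =
      (∫ t, (X * q).eval t ∂densityMeasure I ρ) -
        (∫ t, t ∂densityMeasure I ρ) * ∫ t, q.eval t ∂densityMeasure I ρ := by
  have := hρ.isProbabilityMeasure
  have hs := hρ.moments
  induction q using Polynomial.induction_on' with
  | add p q hp hq =>
    simp only [secondary_add hs]
    rw [integral_add (integrable_secondary hs hμ.moments p)
      (integrable_secondary hs hμ.moments q), hp, hq, mul_add]
    simp only [eval_add]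
    rw [integral_add (integrable_eval hs _) (integrable_eval hs _),
      integral_add (integrable_eval hs _) (integrable_eval hs _)]
    ring
  | monomial n a =>
    have e : monomial n a = a • (X ^ n : ℝ[X]) := by rw [smul_X_eq_monomial]
    rw [e]
    simp only [secondary_smul]
    simp only [mul_smul_comm, eval_smul, smul_eq_mul, integral_const_mul]
    rw [mul_left_comm, ← mul_sub]
    congr 1
    cases n with
    | zero =>
      rw [pow_zero, ← C_1]
      simp only [secondary_C]
      simp
    | succ n =>
      simp only [secondary_X_pow hs]
      rw [integral_finsetSum _ fun p _ => (hμ.moments _).mul_const _]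
      simp only [integral_mul_const]
      rw [moment_relation hρ hμ]
      simp [pow_succ, mul_comm]

theorem integral_secondary_mul_secondary {I : Set ℝ} {ρ μ : ℝ → ℝ}
    (hρ : IsAdmissibleDensity I ρ) (hμ : IsSecondaryDensity I ρ μ) (p q : ℝ[X]) :
    ∫ x, secondary (densityMeasure I ρ) (fun t => p.eval t) x *
        secondary (densityMeasure I ρ) (fun t => q.eval t) x ∂densityMeasure I μ =
      (∫ t, p.eval t * q.eval t ∂densityMeasure I ρ) -
        (∫ t, p.eval t ∂densityMeasure I ρ) * ∫ t, q.eval t ∂densityMeasure I ρ := by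
  have := hρ.isProbabilityMeasure
  have hs := hρ.moments
  have hint : ∀ p q : ℝ[X], Integrable (fun x =>
      secondary (densityMeasure I ρ) (fun t => p.eval t) x *
        secondary (densityMeasure I ρ) (fun t => q.eval t) x) (densityMeasure I μ) :=
    fun p q => (memLp_secondary hs hμ.moments p).integrable_mul
      (memLp_secondary hs hμ.moments q)
  have hint2 : ∀ p q : ℝ[X], Integrable (fun x => p.eval x * q.eval x)
      (densityMeasure I ρ) := fun p q =>
    (memLp_eval hs p).integrable_mul (memLp_eval hs q)
  induction p using Polynomial.induction_on' generalizing q with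
  | add p p' hp hp' =>
    simp only [secondary_add hs]
    simp only [add_mul, eval_add]
    rw [integral_add (hint _ _) (hint _ _), hp, hp', integral_add (hint2 _ _) (hint2 _ _),
      integral_add (integrable_eval hs _) (integrable_eval hs _)]
    ring
  | monomial n a =>
    induction n generalizing q with
    | zero =>
      rw [monomial_zero_left]
      simp only [secondary_C, zero_mul, integral_zero]
      simp [integral_const_mul]
    | succ n ih =>
      have e : monomial (n + 1) a = X * monomial n a := by rw [X_mul_monomial]
      rw [e]
      set p := monomial n a
      -- The factor `X` moves from `p` to `q`: expanded by `secondary_X_mul`, the two sides differ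
      -- only by products of means with integrals that `integral_secondary` evaluates.
      have h1 := ih (X * q)
      simp only [secondary_X_mul hs] at h1 ⊢
      simp only [add_mul, mul_add] at h1 ⊢
      have hxs : Integrable (fun x => secondary (densityMeasure I ρ) (fun t => p.eval t) x *
          (x * secondary (densityMeasure I ρ) (fun t => q.eval t) x)) (densityMeasure I μ) := by
        obtain ⟨q', hq'⟩ := exists_secondary_eq_eval hs q
        obtain ⟨p', hp'⟩ := exists_secondary_eq_eval hs p
        refine (integrable_eval hμ.moments (p' * (X * q'))).congr (.of_forall fun x => ?_)
        simp [hp', hq']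
      have hxs' := hxs
      rw [show (fun x => secondary (densityMeasure I ρ) (fun t => p.eval t) x *
          (x * secondary (densityMeasure I ρ) (fun t => q.eval t) x)) = fun x =>
          x * secondary (densityMeasure I ρ) (fun t => p.eval t) x *
          secondary (densityMeasure I ρ) (fun t => q.eval t) x by ext x; ring] at hxs'
      rw [integral_add hxs ((integrable_secondary hs hμ.moments p).mul_const _),
        integral_mul_const, integral_secondary hρ hμ] at h1
      rw [integral_add hxs' ((integrable_secondary hs hμ.moments q).const_mul _),
        integral_const_mul, integral_secondary hρ hμ]
      have e1 : ∀ x : ℝ, x * secondary (densityMeasure I ρ) (fun t => p.eval t) x *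
          secondary (densityMeasure I ρ) (fun t => q.eval t) x =
          secondary (densityMeasure I ρ) (fun t => p.eval t) x *
          (x * secondary (densityMeasure I ρ) (fun t => q.eval t) x) := fun x => by ring
      have e2 : ∀ x : ℝ, (X * p).eval x * q.eval x = p.eval x * (X * q).eval x := fun x => by
        simp only [eval_mul, eval_X]; ring
      simp only [e1, e2]
      linear_combination h1

/-! ### The operator `T_ρ` -/

theorem coeFn_polyToLp {ν : Measure ℝ} (h : HasMoments ν) (p : ℝ[X]) :
    polyToLp ν h p =ᵐ[ν] fun t => p.eval t :=
  (memLp_eval h p).coeFn_toLp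

theorem coeFn_secondaryOnPoly {I : Set ℝ} {ρ μ : ℝ → ℝ} (hρ : HasMoments (densityMeasure I ρ))
    (hμ : HasMoments (densityMeasure I μ)) (p : ℝ[X]) :
    secondaryOnPoly I ρ μ hρ hμ p =ᵐ[densityMeasure I μ]
      secondary (densityMeasure I ρ) fun t => p.eval t :=
  (memLp_secondary hρ hμ p).coeFn_toLp

theorem inner_polyToLp {ν : Measure ℝ} (h : HasMoments ν) (f : Lp ℝ 2 ν) (q : ℝ[X]) :
    inner ℝ f (polyToLp ν h q) = ∫ t, f t * q.eval t ∂ν := by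
  rw [L2.inner_def]
  refine integral_congr_ae ?_
  filter_upwards [coeFn_polyToLp h q] with t ht
  rw [ht]
  simp [mul_comm]

theorem inner_secondaryOnPoly {I : Set ℝ} {ρ μ : ℝ → ℝ} (hρ : HasMoments (densityMeasure I ρ))
    (hμ : HasMoments (densityMeasure I μ)) (f : Lp ℝ 2 (densityMeasure I μ)) (q : ℝ[X]) :
    inner ℝ f (secondaryOnPoly I ρ μ hρ hμ q) =
      ∫ t, f t * secondary (densityMeasure I ρ) (fun t => q.eval t) t ∂densityMeasure I μ := by
  rw [L2.inner_def]
  refine integral_congr_ae ?_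
  filter_upwards [coeFn_secondaryOnPoly hρ hμ q] with t ht
  rw [ht]
  simp [mul_comm]

/-- The squared norm loses only `(∫ p ρ)² ≥ 0`. This contraction bound, with density, ensures that
`secondaryOperator` really extends the operator on polynomials. -/
theorem norm_secondaryOnPoly_le {I : Set ℝ} {ρ μ : ℝ → ℝ}
    (hρ : IsAdmissibleDensity I ρ) (hμ : IsSecondaryDensity I ρ μ) (p : ℝ[X]) :
    ‖secondaryOnPoly I ρ μ hρ.moments hμ.moments p‖ ≤
      1 * ‖polyToLp (densityMeasure I ρ) hρ.moments p‖ := by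
  rw [one_mul]
  refine (sq_le_sq₀ (norm_nonneg _) (norm_nonneg _)).1 ?_
  rw [← real_inner_self_eq_norm_sq, ← real_inner_self_eq_norm_sq, inner_secondaryOnPoly,
    inner_polyToLp]
  have h1 : ∫ t, secondaryOnPoly I ρ μ hρ.moments hμ.moments p t *
      secondary (densityMeasure I ρ) (fun t => p.eval t) t ∂densityMeasure I μ =
      ∫ t, secondary (densityMeasure I ρ) (fun t => p.eval t) t *
      secondary (densityMeasure I ρ) (fun t => p.eval t) t ∂densityMeasure I μ := by
    refine integral_congr_ae ?_
    filter_upwards [coeFn_secondaryOnPoly hρ.moments hμ.moments p] with t ht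
    rw [ht]
  have h2 : ∫ t, polyToLp (densityMeasure I ρ) hρ.moments p t * p.eval t ∂densityMeasure I ρ =
      ∫ t, p.eval t * p.eval t ∂densityMeasure I ρ := by
    refine integral_congr_ae ?_
    filter_upwards [coeFn_polyToLp hρ.moments p] with t ht
    rw [ht]
  rw [h1, h2, integral_secondary_mul_secondary hρ hμ]
  nlinarith [mul_self_nonneg (∫ t, p.eval t ∂densityMeasure I ρ)]

theorem secondaryOperator_polyToLp {I : Set ℝ} {ρ μ : ℝ → ℝ}
    (hρ : IsAdmissibleDensity I ρ) (hμ : IsSecondaryDensity I ρ μ) (p : ℝ[X]) :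
    secondaryOperator I ρ μ hρ.moments hμ.moments (polyToLp (densityMeasure I ρ) hρ.moments p) =
      secondaryOnPoly I ρ μ hρ.moments hμ.moments p :=
  LinearMap.extendOfNorm_eq hρ.dense ⟨1, norm_secondaryOnPoly_le hρ hμ⟩ p

theorem integral_secondaryOperator_mul_secondary {I : Set ℝ} {ρ μ : ℝ → ℝ}
    (hρ : IsAdmissibleDensity I ρ) (hμ : IsSecondaryDensity I ρ μ)
    (f : Lp ℝ 2 (densityMeasure I ρ)) (q : ℝ[X]) :
    ∫ x, secondaryOperator I ρ μ hρ.moments hμ.moments f x *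
        secondary (densityMeasure I ρ) (fun t => q.eval t) x ∂densityMeasure I μ =
      (∫ t, f t * q.eval t ∂densityMeasure I ρ) -
        (∫ t, f t ∂densityMeasure I ρ) * ∫ t, q.eval t ∂densityMeasure I ρ := by
  have hone : ∫ t, f t ∂densityMeasure I ρ =
      inner ℝ f (polyToLp (densityMeasure I ρ) hρ.moments 1) := by
    rw [inner_polyToLp]; simp
  rw [← inner_secondaryOnPoly hρ.moments hμ.moments, ← inner_polyToLp hρ.moments, hone]
  refine hρ.dense.induction (P := fun f => inner ℝ
    (secondaryOperator I ρ μ hρ.moments hμ.moments f) _ = inner ℝ f _ - inner ℝ f _ * _) ?_ ?_ f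
  · rintro _ ⟨p, rfl⟩
    rw [secondaryOperator_polyToLp hρ hμ, inner_secondaryOnPoly, inner_polyToLp, inner_polyToLp]
    have h1 := integral_secondary_mul_secondary hρ hμ p q
    convert h1 using 1
    · refine integral_congr_ae ?_
      filter_upwards [coeFn_secondaryOnPoly hρ.moments hμ.moments p] with t ht
      rw [ht]
    · congr 1
      · refine integral_congr_ae ?_
        filter_upwards [coeFn_polyToLp hρ.moments p] with t ht
        rw [ht]
      · congr 1
        refine integral_congr_ae ?_
        filter_upwards [coeFn_polyToLp hρ.moments p] with t ht
        rw [ht]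
        simp
  · exact isClosed_eq (by fun_prop) (by fun_prop)

/-! ### Poisson integrals and absolute continuity -/

/-- The Poisson integral `∫ ε / ((x - t)² + ε²) dν(t)`. -/
noncomputable def poissonIntegral (ν : Measure ℝ) (ε x : ℝ) : ℝ :=
  ∫ t, ε / ((x - t) ^ 2 + ε ^ 2) ∂ν

theorem poisson_kernel_le {ε : ℝ} (hε : 0 < ε) (s : ℝ) : ε / (s ^ 2 + ε ^ 2) ≤ 1 / ε := by
  rw [div_le_div_iff₀ (by positivity) hε]
  nlinarith [sq_nonneg s]

theorem abs_conjugate_kernel_le {ε : ℝ} (hε : 0 < ε) (s : ℝ) :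
    |s / (s ^ 2 + ε ^ 2)| ≤ 1 / ε := by
  rw [abs_div, abs_of_pos (by positivity : 0 < s ^ 2 + ε ^ 2),
    div_le_div_iff₀ (by positivity) hε]
  nlinarith [sq_abs s, sq_nonneg (|s| - ε), abs_nonneg s]

theorem integrable_poisson_kernel (ν : Measure ℝ) [IsFiniteMeasure ν] {ε : ℝ} (hε : 0 < ε)
    (x : ℝ) : Integrable (fun t => ε / ((x - t) ^ 2 + ε ^ 2)) ν := by
  refine (integrable_const (1 / ε)).mono' (Measurable.aestronglyMeasurable (by fun_prop)) ?_
  refine .of_forall fun t => ?_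
  rw [Real.norm_of_nonneg (by positivity)]
  exact poisson_kernel_le hε _

theorem integrable_conjugate_kernel (ν : Measure ℝ) [IsFiniteMeasure ν] {ε : ℝ} (hε : 0 < ε)
    (x : ℝ) : Integrable (fun t => (x - t) / ((x - t) ^ 2 + ε ^ 2)) ν := by
  refine (integrable_const (1 / ε)).mono' (Measurable.aestronglyMeasurable (by fun_prop)) ?_
  exact .of_forall fun t => abs_conjugate_kernel_le hε _

theorem stieltjes_eq_reducerApprox_sub_poissonIntegral (ν : Measure ℝ) [IsFiniteMeasure ν]
    {ε : ℝ} (hε : 0 < ε) (x : ℝ) :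
    stieltjes ν (x + ε * Complex.I) =
      ((reducerApprox ν ε x / 2 : ℝ) : ℂ) - (poissonIntegral ν ε x : ℂ) * Complex.I := by
  have h : ∀ t : ℝ, 1 / ((x : ℂ) + ε * Complex.I - (t : ℂ)) =
      (((x - t) / ((x - t) ^ 2 + ε ^ 2) : ℝ) : ℂ) -
        ((ε / ((x - t) ^ 2 + ε ^ 2) : ℝ) : ℂ) * Complex.I := fun t => by
    have h1 : (((x - t) ^ 2 + ε ^ 2 : ℝ) : ℂ) ≠ 0 := by
      exact_mod_cast (by positivity : (x - t) ^ 2 + ε ^ 2 ≠ 0)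
    have h2 : (x : ℂ) + ε * Complex.I - (t : ℂ) ≠ 0 := fun h0 => by
      have := congrArg Complex.im h0
      simp at this
      exact hε.ne' this
    push_cast at h1 ⊢
    field_simp
    linear_combination (ε : ℂ) ^ 2 * Complex.I_sq
  simp only [stieltjes, h]
  rw [integral_sub (integrable_conjugate_kernel ν hε x).ofReal
    ((integrable_poisson_kernel ν hε x).ofReal.mul_const _), integral_mul_const,
    integral_complex_ofReal, integral_complex_ofReal, reducerApprox, poissonIntegral,
    mul_div_cancel_left₀ _ two_ne_zero]

theorem ofReal_poissonIntegral (ν : Measure ℝ) [IsFiniteMeasure ν] {ε : ℝ} (hε : 0 < ε) (x : ℝ) :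
    ENNReal.ofReal (poissonIntegral ν ε x) =
      ∫⁻ t, ENNReal.ofReal (ε / ((x - t) ^ 2 + ε ^ 2)) ∂ν :=
  ofReal_integral_eq_lintegral_ofReal (integrable_poisson_kernel ν hε x)
    (.of_forall fun t => by positivity)

theorem lintegral_poisson_kernel {ε : ℝ} (hε : 0 < ε) (x : ℝ) :
    ∫⁻ t, ENNReal.ofReal (ε / ((x - t) ^ 2 + ε ^ 2)) = ENNReal.ofReal Real.pi := by
  lift ε to NNReal using hε.le
  have h1 : ∀ t, (ε : ℝ) / ((x - t) ^ 2 + (ε : ℝ) ^ 2) =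
      Real.pi * ProbabilityTheory.cauchyPDFReal x ε t := fun t => by
    rw [ProbabilityTheory.cauchyPDFReal_def, ← mul_assoc, ← mul_assoc,
      mul_inv_cancel₀ Real.pi_ne_zero, one_mul, div_eq_mul_inv]
    congr 3
    ring
  have h2 := ProbabilityTheory.integral_cauchyPDFReal_eq_one x (γ := ε)
    (fun h => hε.ne' (by rw [h]; rfl))
  simp only [h1]
  rw [← ofReal_integral_eq_lintegral_ofReal, integral_const_mul, h2, mul_one]
  · exact (Integrable.of_integral_ne_zero (by rw [h2]; exact one_ne_zero)).const_mul _
  · refine .of_forall fun t => ?_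
    change 0 ≤ Real.pi * _
    rw [← h1]
    positivity

theorem densityMeasure_apply_of_subset {I s : Set ℝ} (ρ : ℝ → ℝ) (hs : MeasurableSet s)
    (hsI : s ⊆ I) : densityMeasure I ρ s = ∫⁻ t in s, ENNReal.ofReal (ρ t) := by
  rw [densityMeasure, withDensity_apply _ hs, Measure.restrict_restrict hs,
    Set.inter_eq_left.2 hsI]

/-- On a ball of radius `δ` about `x`, continuity keeps `ρ` between `ρ x / 2` and `ρ x + 1`. From
below, the kernel is at least `1 / (2ε)` on a ball of length `2ε`. From above, the kernel has
Lebesgue integral `π`, and off the `δ`-ball it is at most `1 / δ²` once `ε < 1`. -/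
theorem eventually_poissonIntegral_bounds {I : Set ℝ} {ρ : ℝ → ℝ} (hρ : IsAdmissibleDensity I ρ)
    {x : ℝ} (hx : x ∈ interior I) (hpos : 0 < ρ x) :
    ∃ c > 0, ∃ B, ∀ᶠ ε in 𝓝[>] (0 : ℝ), c ≤ poissonIntegral (densityMeasure I ρ) ε x ∧
      poissonIntegral (densityMeasure I ρ) ε x ≤ B := by
  have := hρ.isProbabilityMeasure
  have hI : I ∈ 𝓝 x := mem_interior_iff_mem_nhds.1 hx
  have hc : ContinuousAt ρ x := hρ.continuousOn.continuousAt hI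
  obtain ⟨δ, hδ, hball⟩ := Metric.nhds_basis_closedBall.mem_iff.1
    (inter_mem hI (hc.eventually (Icc_mem_nhds (a := ρ x / 2) (b := ρ x + 1)
      (by linarith) (by linarith))))
  refine ⟨ρ x / 2, by positivity, (ρ x + 1) * Real.pi + 1 / δ ^ 2, ?_⟩
  filter_upwards [Ioo_mem_nhdsGT (lt_min hδ one_pos)] with ε hε
  obtain ⟨hε0, hε1⟩ := hε
  obtain ⟨hεδ, hε1⟩ := lt_min_iff.1 hε1
  have hsub : Metric.closedBall x ε ⊆ Metric.closedBall x δ :=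
    Metric.closedBall_subset_closedBall hεδ.le
  constructor
  · rw [← ENNReal.ofReal_le_ofReal_iff (by unfold poissonIntegral; positivity),
      ofReal_poissonIntegral _ hε0]
    calc ENNReal.ofReal (ρ x / 2)
        = ENNReal.ofReal (1 / (2 * ε)) * (ENNReal.ofReal (ρ x / 2) *
            volume (Metric.closedBall x ε)) := by
          rw [Real.volume_closedBall, ← ENNReal.ofReal_mul (by positivity),
            ← ENNReal.ofReal_mul (by positivity)]
          congr 1
          field_simp
      _ ≤ ENNReal.ofReal (1 / (2 * ε)) * densityMeasure I ρ (Metric.closedBall x ε) := by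
          gcongr
          rw [densityMeasure_apply_of_subset ρ Metric.isClosed_closedBall.measurableSet
            (hsub.trans fun t ht => (hball ht).1), ← setLIntegral_const]
          refine setLIntegral_mono' Metric.isClosed_closedBall.measurableSet fun t ht => ?_
          exact ENNReal.ofReal_le_ofReal (hball (hsub ht)).2.1
      _ = ∫⁻ t in Metric.closedBall x ε, ENNReal.ofReal (1 / (2 * ε)) ∂densityMeasure I ρ := by
          rw [setLIntegral_const]
      _ ≤ ∫⁻ t in Metric.closedBall x ε,
            ENNReal.ofReal (ε / ((x - t) ^ 2 + ε ^ 2)) ∂densityMeasure I ρ := by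
          refine setLIntegral_mono' Metric.isClosed_closedBall.measurableSet fun t ht => ?_
          refine ENNReal.ofReal_le_ofReal ?_
          rw [Metric.mem_closedBall, Real.dist_eq, abs_sub_comm] at ht
          have := sq_le_sq' (by linarith [abs_nonneg (x - t)] : -ε ≤ |x - t|) ht
          rw [sq_abs] at this
          rw [div_le_div_iff₀ (by positivity) (by positivity)]
          nlinarith
      _ ≤ _ := setLIntegral_le_lintegral _ _
  · rw [← ENNReal.ofReal_le_ofReal_iff (by positivity), ofReal_poissonIntegral _ hε0,
      ← lintegral_add_compl _ (Metric.isClosed_closedBall (x := x) (ε := δ)).measurableSet,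
      ENNReal.ofReal_add (by positivity) (by positivity)]
    refine add_le_add ?_ ?_
    · have hle : (densityMeasure I ρ).restrict (Metric.closedBall x δ) ≤
          ENNReal.ofReal (ρ x + 1) • volume := by
        refine Measure.le_iff.2 fun s hs => ?_
        have hm := hs.inter (Metric.isClosed_closedBall (x := x) (ε := δ)).measurableSet
        rw [Measure.restrict_apply hs, densityMeasure_apply_of_subset ρ hm
          (Set.inter_subset_right.trans fun t ht => (hball ht).1), Measure.smul_apply, smul_eq_mul]
        calc _ ≤ ∫⁻ t in s ∩ Metric.closedBall x δ, ENNReal.ofReal (ρ x + 1) :=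
              setLIntegral_mono' hm fun t ht => ENNReal.ofReal_le_ofReal (hball ht.2).2.2
          _ ≤ _ := by
              rw [setLIntegral_const]
              gcongr
              exact Set.inter_subset_left
      refine (lintegral_mono' hle le_rfl).trans ?_
      rw [lintegral_smul_measure, lintegral_poisson_kernel hε0, smul_eq_mul,
        ← ENNReal.ofReal_mul (by positivity)]
    · calc _ ≤ ∫⁻ t in (Metric.closedBall x δ)ᶜ, ENNReal.ofReal (1 / δ ^ 2)
            ∂densityMeasure I ρ := by
            refine setLIntegral_mono' Metric.isClosed_closedBall.measurableSet.compl
              fun t ht => ENNReal.ofReal_le_ofReal ?_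
            rw [Set.mem_compl_iff, Metric.mem_closedBall, Real.dist_eq, abs_sub_comm, not_le] at ht
            have := sq_lt_sq' (by linarith : -|x - t| < δ) ht
            rw [sq_abs] at this
            rw [div_le_div_iff₀ (by positivity) (by positivity)]
            nlinarith
        _ ≤ _ := by
            refine (setLIntegral_le_lintegral _ _).trans ?_
            simp

/-- The imaginary part of the Stieltjes equation at `x + iε` gives `p / ((a/2)² + p²) - ε` for the
Poisson integral of `μ`, where `p` is that of `ρ` and `a` is the approximate reducer. Here `p` stays
between positive constants and `a` is bounded because it converges. -/
theorem eventually_le_poissonIntegral_secondary {I : Set ℝ} {ρ μ : ℝ → ℝ}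
    (hρ : IsAdmissibleDensity I ρ) (hμ : IsSecondaryDensity I ρ μ)
    {x : ℝ} (hx : x ∈ interior I) (hpos : 0 < ρ x) {l : ℝ}
    (hl : Tendsto (fun ε => reducerApprox (densityMeasure I ρ) ε x) (𝓝[>] 0) (𝓝 l)) :
    ∃ c > 0, ∀ᶠ ε in 𝓝[>] (0 : ℝ), c ≤ poissonIntegral (densityMeasure I μ) ε x := by
  have := hρ.isProbabilityMeasure
  have := hμ.moments.isFiniteMeasure
  obtain ⟨c, hc, B, hB⟩ := eventually_poissonIntegral_bounds hρ hx hpos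
  set D := (|l| + 1) ^ 2 + B ^ 2 with hD
  have hD0 : 0 < D := by positivity
  -- The quotient is at least `c / D`; half of it is given up to absorb the term `-ε`.
  refine ⟨c / D / 2, by positivity, ?_⟩
  have h1 : ∀ᶠ ε in 𝓝[>] (0 : ℝ), |reducerApprox (densityMeasure I ρ) ε x| < |l| + 1 :=
    hl.abs.eventually (gt_mem_nhds (by linarith))
  filter_upwards [hB, h1, Ioo_mem_nhdsGT (by positivity : 0 < c / D / 2)] with ε hε h2 hε0
  obtain ⟨hε0, hε1⟩ := hε0
  have him : ((x : ℂ) + ε * Complex.I).im ≠ 0 := by simp [hε0.ne']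
  have h3 := congrArg Complex.im (hμ.stieltjes_eq _ him)
  rw [stieltjes_eq_reducerApprox_sub_poissonIntegral _ hε0,
    stieltjes_eq_reducerApprox_sub_poissonIntegral _ hε0] at h3
  set p := poissonIntegral (densityMeasure I ρ) ε x
  set a := reducerApprox (densityMeasure I ρ) ε x
  have h4 : poissonIntegral (densityMeasure I μ) ε x = p / ((a / 2) ^ 2 + p ^ 2) - ε := by
    have h5 : (1 / (((a / 2 : ℝ) : ℂ) - (p : ℂ) * Complex.I)).im = p / ((a / 2) ^ 2 + p ^ 2) := by
      rw [one_div, Complex.inv_im, Complex.normSq_apply]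
      simp
      congr 1
      ring
    rw [Complex.sub_im, Complex.sub_im, h5] at h3
    simp at h3
    linarith
  rw [h4]
  have hp : 0 < p := hc.trans_le hε.1
  have h6 : (a / 2) ^ 2 + p ^ 2 ≤ D := by
    have e1 : a ^ 2 ≤ (|l| + 1) ^ 2 := by
      rw [← sq_abs a]
      exact pow_le_pow_left₀ (abs_nonneg _) h2.le 2
    have e2 : p ^ 2 ≤ B ^ 2 := pow_le_pow_left₀ hp.le hε.2 2
    nlinarith [sq_nonneg a]
  have h7 : c / D ≤ p / ((a / 2) ^ 2 + p ^ 2) :=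
    div_le_div₀ hp.le hε.1 (by positivity) h6
  linarith

/-- After Tonelli, the inner integral over `K` is at most `π`, and it tends to `0` for each `t ∉ K`,
that is for `ν`-almost every `t`, because `t` has positive distance to `K`. Dominated convergence
concludes. -/
theorem tendsto_lintegral_poissonIntegral {ν : Measure ℝ} [IsFiniteMeasure ν] {K : Set ℝ}
    (hK : IsCompact K) (h0 : ν K = 0) {e : ℕ → ℝ} (he : ∀ j, 0 < e j)
    (he0 : Tendsto e atTop (𝓝 0)) :
    Tendsto (fun j => ∫⁻ x in K, ENNReal.ofReal (poissonIntegral ν (e j) x)) atTop (𝓝 0) := by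
  have h1 : ∀ j, ∫⁻ x in K, ENNReal.ofReal (poissonIntegral ν (e j) x) =
      ∫⁻ t, (∫⁻ x in K, ENNReal.ofReal (e j / ((x - t) ^ 2 + e j ^ 2))) ∂ν := fun j => by
    simp only [ofReal_poissonIntegral ν (he j)]
    exact lintegral_lintegral_swap (by fun_prop)
  simp only [h1]
  have h2 := tendsto_lintegral_of_dominated_convergence (μ := ν)
    (F := fun j t => ∫⁻ x in K, ENNReal.ofReal (e j / ((x - t) ^ 2 + e j ^ 2)))
    (f := fun _ => 0) (fun _ => ENNReal.ofReal Real.pi)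
    (fun j => Measurable.lintegral_prod_right' (f := fun z : ℝ × ℝ =>
      ENNReal.ofReal (e j / ((z.2 - z.1) ^ 2 + e j ^ 2))) (by fun_prop))
    (fun j => .of_forall fun t => ?_) ?_ ?_
  · simpa using h2
  · refine (setLIntegral_le_lintegral _ _).trans (le_of_eq ?_)
    rw [← lintegral_poisson_kernel (he j) t]
    congr 1
    ext x
    rw [← neg_sub, neg_sq]
  · rw [lintegral_const]
    exact ENNReal.mul_ne_top ENNReal.ofReal_ne_top (measure_ne_top _ _)
  · have h3 : ∀ᵐ t ∂ν, t ∉ K := measure_eq_zero_iff_ae_notMem.1 h0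
    filter_upwards [h3] with t ht
    obtain ⟨δ, hδ, hball⟩ := Metric.nhds_basis_ball.mem_iff.1 (hK.isClosed.isOpen_compl.mem_nhds ht)
    have h4 : ∀ j, ∫⁻ x in K, ENNReal.ofReal (e j / ((x - t) ^ 2 + e j ^ 2)) ≤
        ENNReal.ofReal (e j / δ ^ 2) * volume K := fun j => by
      rw [← setLIntegral_const]
      refine setLIntegral_mono' hK.measurableSet fun x hx => ENNReal.ofReal_le_ofReal ?_
      have h5 : δ ≤ |x - t| := by
        by_contra! h
        exact hball (by rwa [Metric.mem_ball, Real.dist_eq]) hx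
      have h6 := pow_le_pow_left₀ hδ.le h5 2
      rw [sq_abs] at h6
      exact div_le_div_of_nonneg_left (he j).le (by positivity) (by nlinarith [sq_nonneg (e j)])
    refine tendsto_of_tendsto_of_tendsto_of_le_of_le tendsto_const_nhds ?_
      (fun _ => zero_le) h4
    have h7 : Tendsto (fun j => ENNReal.ofReal (e j / δ ^ 2)) atTop (𝓝 0) := by
      simpa using ENNReal.tendsto_ofReal (he0.div_const (δ ^ 2))
    simpa using ENNReal.Tendsto.mul_const h7 (Or.inr hK.measure_lt_top.ne)

theorem ae_mem_interior {I : Set ℝ} (hI : I.OrdConnected) :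
    ∀ᵐ x ∂volume.restrict I, x ∈ interior I := by
  have h1 : ∀ᵐ x : ℝ, x ∉ frontier I :=
    measure_eq_zero_iff_ae_notMem.1 (hI.convex.addHaar_frontier volume)
  filter_upwards [ae_restrict_of_ae h1, ae_restrict_mem hI.measurableSet] with x h2 h3
  by_contra h4
  exact h2 ⟨subset_closure h3, h4⟩

/-- Otherwise some compact `K` of positive length has `μ = 0` a.e. and `ρ > 0` on it. The Poisson
integrals of `μ` tend to `0` in `L¹(K)`, so by Fatou their lower limit vanishes a.e. on `K`, against
the positive lower bound at points where the reducer exists. -/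
theorem ae_eq_zero_of_secondary_eq_zero {I : Set ℝ} {ρ μ : ℝ → ℝ}
    (hρ : IsAdmissibleDensity I ρ) (hμ : IsSecondaryDensity I ρ μ)
    (hlim : ∀ᵐ x ∂volume.restrict I, ∃ l : ℝ,
      Tendsto (fun ε => reducerApprox (densityMeasure I ρ) ε x) (𝓝[>] 0) (𝓝 l)) :
    ∀ᵐ x ∂volume.restrict I, μ x = 0 → ρ x = 0 := by
  have := hρ.isProbabilityMeasure
  have := hμ.moments.isFiniteMeasure
  obtain ⟨g, hgm, hg⟩ := hμ.aemeasurable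
  set E := (interior I ∩ ρ ⁻¹' Set.Ioi 0) ∩ g ⁻¹' {0} with hE
  have hEI : E ⊆ I := fun x hx => interior_subset hx.1.1
  have hEm : MeasurableSet E :=
    ((hρ.continuousOn.mono interior_subset).isOpen_inter_preimage isOpen_interior
      isOpen_Ioi).measurableSet.inter
      (hgm (measurableSet_singleton 0))
  have hE0 : volume E = 0 := by
    by_contra hne
    obtain ⟨K, hKE, hK, hK0⟩ := hEm.exists_lt_isCompact (pos_iff_ne_zero.2 hne)
    have hKI := hKE.trans hEI
    have hνK : densityMeasure I μ K = 0 := by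
      rw [densityMeasure_apply_of_subset μ hK.measurableSet hKI]
      rw [setLIntegral_congr_fun_ae (g := fun _ => 0) hK.measurableSet, lintegral_zero]
      have h1 := (ae_restrict_iff' hρ.ordConnected.measurableSet).1 hg
      filter_upwards [h1] with x hx hxK
      rw [hx (hKI hxK), show g x = 0 from (hKE hxK).2, ENNReal.ofReal_zero]
    set e : ℕ → ℝ := fun j => 1 / ((j : ℝ) + 1) with he
    have he0 : Tendsto e atTop (𝓝 0) := tendsto_one_div_add_atTop_nhds_zero_nat
    have hepos : ∀ j, 0 < e j := fun j => by positivity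
    have h2 := tendsto_lintegral_poissonIntegral hK hνK hepos he0
    have hmeas : ∀ j, Measurable fun x =>
        ENNReal.ofReal (poissonIntegral (densityMeasure I μ) (e j) x) := fun j => by
      simp only [ofReal_poissonIntegral _ (hepos j)]
      exact Measurable.lintegral_prod_right' (f := fun z : ℝ × ℝ =>
        ENNReal.ofReal (e j / ((z.1 - z.2) ^ 2 + e j ^ 2))) (by fun_prop)
    have h3 := lintegral_liminf_le (μ := volume.restrict K) (u := atTop) hmeas
    rw [h2.liminf_eq, nonpos_iff_eq_zero, lintegral_eq_zero_iff (.liminf hmeas)] at h3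
    have h4 : ∀ᵐ x ∂volume.restrict K, False := by
      filter_upwards [h3, ae_restrict_mem hK.measurableSet,
        ae_restrict_of_ae_restrict_of_subset hKI hlim] with x hx hxK ⟨l, hl⟩
      obtain ⟨c, hc, h5⟩ := eventually_le_poissonIntegral_secondary hρ hμ (hKE hxK).1.1
        (hKE hxK).1.2 hl
      have h6 : Tendsto e atTop (𝓝[>] 0) :=
        tendsto_nhdsWithin_iff.2 ⟨he0, .of_forall hepos⟩
      have h7 : ENNReal.ofReal c ≤ liminf (fun j =>
          ENNReal.ofReal (poissonIntegral (densityMeasure I μ) (e j) x)) atTop :=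
        le_liminf_of_le (by isBoundedDefault) ((h6.eventually h5).mono fun j hj =>
          ENNReal.ofReal_le_ofReal hj)
      rw [hx] at h7
      simp at h7
      linarith
    rw [ae_iff] at h4
    simp at h4
    exact hK0.ne' h4
  have h1 : ∀ᵐ x, x ∉ E := measure_eq_zero_iff_ae_notMem.1 hE0
  filter_upwards [ae_restrict_of_ae h1, ae_mem_interior hρ.ordConnected,
    hg] with x hx hxI hxg h0
  by_contra hne
  exact hx ⟨⟨hxI, lt_of_le_of_ne (hρ.nonneg x (interior_subset hxI)) (Ne.symm hne)⟩,
    by rw [Set.mem_preimage, ← hxg, h0]; exact Set.mem_singleton 0⟩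

/-- Where `μ x = 0` the convention `ρ x / 0 = 0` makes the right side vanish, which is why `ρ` must
vanish there too. -/
theorem densityMeasure_eq_withDensity {I : Set ℝ} {ρ μ : ℝ → ℝ}
    (hρ : IsAdmissibleDensity I ρ) (hμ : IsSecondaryDensity I ρ μ)
    (h : ∀ᵐ x ∂volume.restrict I, μ x = 0 → ρ x = 0) :
    densityMeasure I ρ =
      (densityMeasure I μ).withDensity fun x => ENNReal.ofReal (ρ x / μ x) := by
  have hm := hρ.ordConnected.measurableSet
  have hρm : AEMeasurable ρ (volume.restrict I) := hρ.continuousOn.aemeasurable hm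
  have h1 := withDensity_mul₀ hμ.aemeasurable.ennreal_ofReal
    (hρm.div hμ.aemeasurable).ennreal_ofReal
  refine Eq.trans ?_ h1
  refine withDensity_congr_ae ?_
  filter_upwards [h, ae_restrict_mem hm] with x hx hxI
  rw [Pi.mul_apply, Pi.div_apply, ← ENNReal.ofReal_mul (hμ.nonneg x hxI)]
  congr 1
  by_cases h0 : μ x = 0
  · rw [hx h0, h0, zero_mul]
  · field_simp

/-! ### Difference quotients and the reducer -/

/-- The difference quotient `(h(y) - h(x)) / (y - x)` as a function of `(x, y)`. -/
noncomputable def quotient (h : ℝ → ℝ) (z : ℝ × ℝ) : ℝ :=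
  (h z.2 - h z.1) / (z.2 - z.1)

/-- The kernel is odd under exchange of the variables, so the factor `2` turns `h(x)` into `h(x) -
h(t)`. For `ε > 0` the kernel is bounded, hence Fubini needs only the integrability of `h`. -/
theorem integral_mul_reducerApprox (ν : Measure ℝ) [IsFiniteMeasure ν] {h : ℝ → ℝ}
    (hh : Integrable h ν) {ε : ℝ} (hε : 0 < ε) :
    ∫ x, h x * reducerApprox ν ε x ∂ν =
      ∫ z, quotient h z * ((z.1 - z.2) ^ 2 / ((z.1 - z.2) ^ 2 + ε ^ 2)) ∂ν.prod ν := by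
  set k : ℝ × ℝ → ℝ := fun z => (z.1 - z.2) / ((z.1 - z.2) ^ 2 + ε ^ 2) with hk
  have hkm : AEStronglyMeasurable k (ν.prod ν) :=
    Measurable.aestronglyMeasurable (by fun_prop)
  have hi1 : Integrable (fun z : ℝ × ℝ => k z * h z.1) (ν.prod ν) :=
    (hh.comp_fst ν).bdd_mul hkm (.of_forall fun z => abs_conjugate_kernel_le hε _)
  have hi2 : Integrable (fun z : ℝ × ℝ => k z * h z.2) (ν.prod ν) :=
    (hh.comp_snd ν).bdd_mul hkm (.of_forall fun z => abs_conjugate_kernel_le hε _)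
  have h1 : ∫ x, h x * reducerApprox ν ε x ∂ν = 2 * ∫ z, k z * h z.1 ∂ν.prod ν := by
    rw [integral_prod _ hi1, ← integral_const_mul]
    refine integral_congr_ae (.of_forall fun x => ?_)
    simp only [reducerApprox, hk, integral_mul_const]
    ring
  have h2 : ∫ z, k z * h z.1 ∂ν.prod ν = -∫ z, k z * h z.2 ∂ν.prod ν := by
    rw [← integral_prod_swap, ← integral_neg]
    refine integral_congr_ae (.of_forall fun z => ?_)
    simp only [hk, Prod.fst_swap, Prod.snd_swap]
    rw [show (z.2 - z.1) ^ 2 = (z.1 - z.2) ^ 2 by ring]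
    ring
  rw [h1, two_mul]
  nth_rewrite 2 [h2]
  rw [← sub_eq_add_neg, ← integral_sub hi1 hi2]
  refine integral_congr_ae (.of_forall fun z => ?_)
  simp only [hk, quotient]
  rcases eq_or_ne z.1 z.2 with h0 | h0
  · simp [h0]
  · have e1 : z.2 - z.1 ≠ 0 := sub_ne_zero.2 h0.symm
    have e2 : (z.1 - z.2) ^ 2 + ε ^ 2 ≠ 0 := by positivity
    field_simp
    ring

theorem stronglyMeasurable_reducerApprox (ν : Measure ℝ) [SFinite ν] (ε : ℝ) :
    StronglyMeasurable (reducerApprox ν ε) := by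
  refine StronglyMeasurable.const_mul (StronglyMeasurable.integral_prod_right'
    (f := fun z : ℝ × ℝ => (z.1 - z.2) / ((z.1 - z.2) ^ 2 + ε ^ 2)) ?_) 2
  exact Measurable.stronglyMeasurable (by fun_prop)

theorem memLp_reducerApprox (ν : Measure ℝ) [IsFiniteMeasure ν] {ε : ℝ} (hε : 0 < ε) :
    MemLp (reducerApprox ν ε) 2 ν := by
  refine MemLp.of_bound (stronglyMeasurable_reducerApprox ν ε).aestronglyMeasurable
    (2 * (1 / ε * ν.real Set.univ)) (.of_forall fun x => ?_)
  rw [reducerApprox, norm_mul, Real.norm_ofNat]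
  gcongr
  exact norm_integral_le_of_norm_le_const (.of_forall fun t => abs_conjugate_kernel_le hε _)

theorem tendsto_integral_mul_of_tendsto_eLpNorm {ι α : Type*} [MeasurableSpace α]
    {ν : Measure α} {l : Filter ι} {F : ι → α → ℝ} {g h : α → ℝ} (hh : MemLp h 2 ν)
    (hg : MemLp g 2 ν) (hF : ∀ᶠ i in l, MemLp (F i) 2 ν)
    (hlim : Tendsto (fun i => eLpNorm (fun x => F i x - g x) 2 ν) l (𝓝 0)) :
    Tendsto (fun i => ∫ x, h x * F i x ∂ν) l (𝓝 (∫ x, h x * g x ∂ν)) := by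
  refine tendsto_integral_of_L1' _ (hh.integrable_mul hg).1
    (hF.mono fun i hi => hh.integrable_mul hi) ?_
  have h1 : Tendsto (fun i => eLpNorm h 2 ν * eLpNorm (fun x => F i x - g x) 2 ν) l (𝓝 0) := by
    simpa using ENNReal.Tendsto.const_mul hlim (Or.inr hh.2.ne)
  refine tendsto_of_tendsto_of_tendsto_of_le_of_le' tendsto_const_nhds h1
    (.of_forall fun _ => zero_le) ?_
  filter_upwards [hF] with i hi
  have h2 := eLpNorm_smul_le_mul_eLpNorm (p := 2) (q := 2) (r := 1) (hi.1.sub hg.1) hh.1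
  refine (le_of_eq ?_).trans h2
  congr 1
  ext x
  simp only [Pi.sub_apply, Pi.smul_apply', Pi.mul_apply, smul_eq_mul]
  ring

theorem integral_quotient_eq {ν : Measure ℝ} [IsFiniteMeasure ν] {φ h : ℝ → ℝ}
    (hφ : MemLp φ 2 ν)
    (hlim : Tendsto (fun ε => eLpNorm (fun x => reducerApprox ν ε x - φ x) 2 ν) (𝓝[>] 0) (𝓝 0))
    (hh : MemLp h 2 ν) (hq : Integrable (quotient h) (ν.prod ν)) :
    ∫ z, quotient h z ∂ν.prod ν = ∫ x, h x * φ x ∂ν := by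
  have hpos : ∀ᶠ ε in 𝓝[>] (0 : ℝ), 0 < ε := self_mem_nhdsWithin
  have h1 := tendsto_integral_mul_of_tendsto_eLpNorm hh hφ
    (hpos.mono fun ε hε => memLp_reducerApprox ν hε) hlim
  refine tendsto_nhds_unique ?_ h1
  have h2 : Tendsto (fun ε => ∫ z, quotient h z *
      ((z.1 - z.2) ^ 2 / ((z.1 - z.2) ^ 2 + ε ^ 2)) ∂ν.prod ν) (𝓝[>] 0)
      (𝓝 (∫ z, quotient h z ∂ν.prod ν)) := by
    refine tendsto_integral_filter_of_dominated_convergence (fun z => ‖quotient h z‖)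
      (.of_forall fun ε => hq.1.mul (Measurable.aestronglyMeasurable (by fun_prop)))
      ?_ hq.norm (.of_forall fun z => ?_)
    · refine .of_forall fun ε => .of_forall fun z => ?_
      rw [norm_mul]
      refine mul_le_of_le_one_right (norm_nonneg _) ?_
      rw [Real.norm_of_nonneg (by positivity)]
      exact div_le_one_of_le₀ (by nlinarith [sq_nonneg ε]) (by positivity)
    -- On the diagonal `quotient h` is `0` by division by zero, so no exceptional null set is
    -- needed; elsewhere the factor tends to `1`.
    · rcases eq_or_ne z.1 z.2 with h0 | h0
      · simp [quotient, h0]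
      · have e1 : (z.1 - z.2) ^ 2 ≠ 0 := pow_ne_zero 2 (sub_ne_zero.2 h0)
        have h3 : ContinuousAt (fun ε : ℝ => quotient h z *
            ((z.1 - z.2) ^ 2 / ((z.1 - z.2) ^ 2 + ε ^ 2))) 0 := by
          refine continuousAt_const.mul (continuousAt_const.div (by fun_prop) ?_)
          simpa using sub_ne_zero.2 h0
        have h4 := h3.tendsto.mono_left (nhdsWithin_le_nhds (s := Set.Ioi 0))
        simpa [div_self e1] using h4
  refine h2.congr' ?_
  filter_upwards [hpos] with ε hε
  exact (integral_mul_reducerApprox ν (hh.integrable (by norm_num)) hε).symm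

theorem measurable_quotient {h : ℝ → ℝ} (hh : Measurable h) : Measurable (quotient h) := by
  unfold quotient
  fun_prop

theorem integrable_quotient_eval {ν : Measure ℝ} (h : HasMoments ν) (p : ℝ[X]) :
    Integrable (quotient fun t => p.eval t) (ν.prod ν) := by
  have := h.isFiniteMeasure
  induction p using Polynomial.induction_on' with
  | add p q hp hq =>
    refine (hp.add hq).congr (.of_forall fun z => ?_)
    simp only [Pi.add_apply, quotient, eval_add]
    ring
  | monomial n a =>
    have h1 : Integrable (fun z : ℝ × ℝ => ∑ i ∈ Finset.range n,
        a * (z.1 ^ (n - 1 - i) * z.2 ^ i)) (ν.prod ν) :=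
      integrable_finsetSum _ fun i _ => ((h (n - 1 - i)).mul_prod (h i)).const_mul a
    refine h1.mono (measurable_quotient (by fun_prop)).aestronglyMeasurable
      (.of_forall fun z => ?_)
    rcases eq_or_ne z.2 z.1 with h0 | h0
    · simp [quotient, h0]
    · refine le_of_eq (congrArg _ ?_)
      have h2 := (Commute.all z.2 z.1).geom_sum₂_mul n
      rw [quotient, div_eq_iff (sub_ne_zero.2 h0), eval_monomial, eval_monomial, ← mul_sub, ← h2,
        ← mul_assoc, Finset.mul_sum]
      congr 1
      exact Finset.sum_congr rfl fun i _ => by ring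

theorem integral_secondary_eq_integral_mul_reducer {I : Set ℝ} {ρ μ : ℝ → ℝ}
    {hρ : HasMoments (densityMeasure I ρ)} {hμ : HasMoments (densityMeasure I μ)}
    (hred : IsReducible I ρ μ hρ hμ) (p : ℝ[X]) :
    ∫ x, secondary (densityMeasure I ρ) (fun t => p.eval t) x ∂densityMeasure I ρ =
      ∫ x, p.eval x * reducer (densityMeasure I ρ) x ∂densityMeasure I ρ := by
  have := hρ.isFiniteMeasure
  have hq := integrable_quotient_eval hρ p
  rw [← integral_quotient_eq hred.memLp hred.tendsto (memLp_eval hρ p) hq, integral_prod _ hq]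
  rfl

/-! ### A weak formulation with test functions -/

theorem measurable_secondary {ν : Measure ℝ} [SFinite ν] {g : ℝ → ℝ} (hg : Measurable g) :
    Measurable (secondary ν g) :=
  (StronglyMeasurable.integral_prod_right' (f := quotient g)
    (measurable_quotient hg).stronglyMeasurable).measurable

theorem abs_quotient_le {g : ℝ → ℝ} {K : NNReal} (hg : LipschitzWith K g) (z : ℝ × ℝ) :
    |quotient g z| ≤ K := by
  rw [quotient, abs_div]
  refine div_le_of_le_mul₀ (abs_nonneg _) K.2 ?_
  simpa [Real.dist_eq] using hg.dist_le_mul z.2 z.1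

theorem abs_secondary_le {ν : Measure ℝ} [IsProbabilityMeasure ν] {g : ℝ → ℝ} {K : NNReal}
    (hg : LipschitzWith K g) (x : ℝ) : |secondary ν g x| ≤ K := by
  have := norm_integral_le_of_norm_le_const (μ := ν) (C := K)
    (f := fun t => quotient g (x, t)) (.of_forall fun t => abs_quotient_le hg (x, t))
  simpa [secondary, quotient] using this

theorem integrable_quotient_of_lipschitzWith {ν : Measure ℝ} [IsFiniteMeasure ν] {g : ℝ → ℝ}
    {K : NNReal} (hg : LipschitzWith K g) : Integrable (quotient g) (ν.prod ν) :=
  (integrable_const (K : ℝ)).mono'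
    (measurable_quotient hg.continuous.measurable).aestronglyMeasurable
    (.of_forall fun z => abs_quotient_le hg z)

theorem integrable_mul_quotient {ν : Measure ℝ} [IsFiniteMeasure ν] {f g : ℝ → ℝ}
    {K : NNReal} (hf : MemLp f 2 ν) (hg : LipschitzWith K g) :
    Integrable (fun z : ℝ × ℝ => f z.2 * quotient g z) (ν.prod ν) := by
  have h1 := ((hf.integrable (by norm_num)).comp_snd ν).bdd_mul (c := K)
    (measurable_quotient hg.continuous.measurable).aestronglyMeasurable
    (.of_forall fun z => abs_quotient_le hg z)
  simpa [mul_comm] using h1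

/-- A Leibniz rule. For Lipschitz `g` and `f g`, with `f` in `L²`, both terms on the right are
integrable on the product, even if `quotient f` is not. -/
theorem quotient_mul_eq (f g : ℝ → ℝ) (z : ℝ × ℝ) :
    quotient f z * g z.1 = quotient (fun t => f t * g t) z - f z.2 * quotient g z := by
  simp only [quotient]
  ring

theorem integrable_quotient_mul {ν : Measure ℝ} [IsFiniteMeasure ν] {f g : ℝ → ℝ}
    {K L : NNReal} (hf : MemLp f 2 ν) (hg : LipschitzWith K g)
    (hfg : LipschitzWith L fun t => f t * g t) :
    Integrable (fun z : ℝ × ℝ => quotient f z * g z.1) (ν.prod ν) := by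
  simp only [quotient_mul_eq]
  exact (integrable_quotient_of_lipschitzWith hfg).sub (integrable_mul_quotient hf hg)

theorem integral_mul_secondary {ν : Measure ℝ} [IsFiniteMeasure ν] {φ f g : ℝ → ℝ}
    {K L : NNReal} (hφ : MemLp φ 2 ν)
    (hlim : Tendsto (fun ε => eLpNorm (fun x => reducerApprox ν ε x - φ x) 2 ν) (𝓝[>] 0) (𝓝 0))
    (hf : MemLp f 2 ν) (hg : LipschitzWith K g) (hfg : LipschitzWith L fun t => f t * g t)
    (hfg2 : MemLp (fun t => f t * g t) 2 ν) :
    ∫ x, g x * secondary ν f x ∂ν =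
      (∫ x, f x * g x * φ x ∂ν) - ∫ x, f x * secondary ν g x ∂ν := by
  have h1 : ∫ x, g x * secondary ν f x ∂ν = ∫ z, quotient f z * g z.1 ∂ν.prod ν := by
    rw [integral_prod _ (integrable_quotient_mul hf hg hfg)]
    refine integral_congr_ae (.of_forall fun x => ?_)
    simp only [integral_mul_const]
    rw [mul_comm]
    rfl
  have h2 : ∫ x, f x * secondary ν g x ∂ν = ∫ z, f z.2 * quotient g z ∂ν.prod ν := by
    rw [integral_prod_symm _ (integrable_mul_quotient hf hg)]
    refine integral_congr_ae (.of_forall fun x => ?_)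
    simp only [integral_const_mul, secondary]
    congr 2
    ext t
    rw [quotient, ← neg_sub, ← neg_sub x t, neg_div_neg_eq]
  rw [h1, h2, ← integral_quotient_eq hφ hlim hfg2 (integrable_quotient_of_lipschitzWith hfg),
    ← integral_sub (integrable_quotient_of_lipschitzWith hfg) (integrable_mul_quotient hf hg)]
  simp only [quotient_mul_eq]

theorem contDiff_mul_of_tsupport_subset_interior {I : Set ℝ} {f g : ℝ → ℝ}
    (hf : ContDiffOn ℝ 1 f I) (hg : ContDiff ℝ 1 g) (hgI : tsupport g ⊆ interior I) :
    ContDiff ℝ 1 fun t => f t * g t := by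
  refine contDiff_iff_contDiffAt.2 fun x => ?_
  by_cases hx : x ∈ tsupport g
  · exact (hf.contDiffAt (mem_interior_iff_mem_nhds.1 (hgI hx))).mul hg.contDiffAt
  · refine (contDiffAt_const (c := (0 : ℝ))).congr_of_eventuallyEq ?_
    filter_upwards [notMem_tsupport_iff_eventuallyEq.1 hx] with t ht
    rw [ht, Pi.zero_apply, mul_zero]

/-! ### Comparison of the secondary function of a `C¹` function with `T_ρ` -/

section Density

variable {I : Set ℝ} {ρ μ : ℝ → ℝ}

theorem ae_div_nonneg (hρ : IsAdmissibleDensity I ρ) (hμ : IsSecondaryDensity I ρ μ) :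
    ∀ᵐ x ∂densityMeasure I μ, 0 ≤ ρ x / μ x := by
  have h : ∀ᵐ x ∂volume.restrict I, 0 ≤ ρ x / μ x := by
    filter_upwards [ae_restrict_mem hρ.ordConnected.measurableSet] with x hx
    exact div_nonneg (hρ.nonneg x hx) (hμ.nonneg x hx)
  exact (withDensity_absolutelyContinuous _ _).ae_le h

theorem ae_mem_interior_densityMeasure (hI : I.OrdConnected) (ρ : ℝ → ℝ) :
    ∀ᵐ x ∂densityMeasure I ρ, x ∈ interior I :=
  (withDensity_absolutelyContinuous _ _).ae_le (ae_mem_interior hI)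

theorem memLp_div {hρ : HasMoments (densityMeasure I ρ)} {hμ : HasMoments (densityMeasure I μ)}
    (hred : IsReducible I ρ μ hρ hμ) : MemLp (fun x => ρ x / μ x) 2 (densityMeasure I μ) := by
  obtain ⟨g, hg⟩ := hred.exists_preimage
  exact (Lp.memLp _).ae_eq hg

theorem continuous_integral_mul {ν : Measure ℝ} {h : ℝ → ℝ} (hh : MemLp h 2 ν) :
    Continuous fun f : Lp ℝ 2 ν => ∫ x, f x * h x ∂ν := by
  have h2 : (fun f : Lp ℝ 2 ν => ∫ x, f x * h x ∂ν) = fun f => inner ℝ f hh.toLp := by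
    ext f
    rw [L2.inner_def]
    refine integral_congr_ae ?_
    filter_upwards [hh.coeFn_toLp] with x hx
    rw [hx]
    simp [mul_comm]
  rw [h2]
  fun_prop

/-- Differentiability within `I` bounds the quotient near `x`, end points included; at distance at
least `δ` it is at most `(|f y| + |f x|) / δ`, which is integrable. -/
theorem integrable_quotient_of_contDiffOn (hρ : IsAdmissibleDensity I ρ) {f : ℝ → ℝ} (hf : ContDiffOn ℝ 1 f I)
    (hf2 : MemLp f 2 (densityMeasure I ρ)) {x : ℝ} (hx : x ∈ I) :
    Integrable (fun y => (f y - f x) / (y - x)) (densityMeasure I ρ) := by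
  have := hρ.isProbabilityMeasure
  have hf1 : Integrable f (densityMeasure I ρ) := hf2.integrable (by norm_num)
  obtain ⟨C, hC0, hC⟩ := ((hf.differentiableOn one_ne_zero) x hx).isBigO_sub.exists_pos
  obtain ⟨δ, hδ, hball⟩ := Metric.mem_nhdsWithin_iff.1 hC.bound
  have hm : AEStronglyMeasurable (fun y => (f y - f x) / (y - x)) (densityMeasure I ρ) :=
    ((hf1.1.aemeasurable.sub_const _).div (by fun_prop)).aestronglyMeasurable
  refine (((hf1.norm.add (integrable_const |f x|)).div_const δ).add
    (integrable_const C)).mono' hm ?_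
  filter_upwards [ae_mem_interior_densityMeasure hρ.ordConnected ρ] with y hy
  simp only [Pi.add_apply, norm_div, Real.norm_eq_abs]
  rcases lt_or_ge |y - x| δ with h | h
  · have h1 := hball ⟨by rwa [Metric.mem_ball, Real.dist_eq], interior_subset hy⟩
    simp only [Set.mem_ofPred_eq, Real.norm_eq_abs] at h1
    have h2 : |f y - f x| / |y - x| ≤ C := div_le_of_le_mul₀ (abs_nonneg _) hC0.le h1
    have h3 : 0 ≤ (|f y| + |f x|) / δ := by positivity
    linarith
  · have h2 : |f y - f x| / |y - x| ≤ (|f y| + |f x|) / δ :=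
      div_le_div₀ (by positivity) (abs_sub _ _) hδ h
    linarith

variable (hρ : IsAdmissibleDensity I ρ) (hμ : IsSecondaryDensity I ρ μ)
  (hred : IsReducible I ρ μ hρ.moments hμ.moments)

include hred

theorem densityMeasure_eq_withDensity_div :
    densityMeasure I ρ =
      (densityMeasure I μ).withDensity fun x => ENNReal.ofReal (ρ x / μ x) :=
  densityMeasure_eq_withDensity hρ hμ (ae_eq_zero_of_secondary_eq_zero hρ hμ hred.exists_lim)

/-- Values of `T_ρ` are only classes modulo `μ`-null sets; this allows them to be integrated against
`ρ`. -/
theorem absolutelyContinuous_secondary : densityMeasure I ρ ≪ densityMeasure I μ := by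
  rw [densityMeasure_eq_withDensity_div hρ hμ hred]
  exact withDensity_absolutelyContinuous _ _

theorem integral_densityMeasure_eq (h : ℝ → ℝ) :
    ∫ x, h x ∂densityMeasure I ρ = ∫ x, ρ x / μ x * h x ∂densityMeasure I μ := by
  rw [densityMeasure_eq_withDensity_div hρ hμ hred,
    integral_withDensity_eq_integral_toReal_smul₀
      (memLp_div hred).1.aemeasurable.ennreal_ofReal (.of_forall fun _ => ENNReal.ofReal_lt_top)]
  refine integral_congr_ae ?_
  filter_upwards [ae_div_nonneg hρ hμ] with x hx
  rw [ENNReal.toReal_ofReal hx, smul_eq_mul]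

/-- Cauchy–Schwarz in `L²(μ)` against `ρ/μ`. -/
theorem integrable_of_memLp_secondary {h : ℝ → ℝ} (hh : MemLp h 2 (densityMeasure I μ)) :
    Integrable h (densityMeasure I ρ) := by
  rw [densityMeasure_eq_withDensity_div hρ hμ hred, integrable_withDensity_iff_integrable_smul₀'
    (memLp_div hred).1.aemeasurable.ennreal_ofReal (.of_forall fun _ => ENNReal.ofReal_lt_top)]
  refine ((memLp_div hred).integrable_mul hh).congr ?_
  filter_upwards [ae_div_nonneg hρ hμ] with x hx
  rw [ENNReal.toReal_ofReal hx, smul_eq_mul, Pi.mul_apply]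

theorem coeFn_secondaryOperator_polyToLp (p : ℝ[X]) :
    secondaryOperator I ρ μ hρ.moments hμ.moments
        (polyToLp (densityMeasure I ρ) hρ.moments p) =ᵐ[densityMeasure I ρ]
      secondary (densityMeasure I ρ) fun t => p.eval t := by
  rw [secondaryOperator_polyToLp hρ hμ]
  exact (absolutelyContinuous_secondary hρ hμ hred).ae_le
    (coeFn_secondaryOnPoly hρ.moments hμ.moments p)

/-- The integral against `ρ` is an inner product in `L²(μ)` with `g ρ/μ`, which is square integrable
because `g` is bounded. -/
theorem continuous_integral_secondaryOperator {g : ℝ → ℝ} {K : ℝ} (hg : Measurable g)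
    (hK : ∀ x, |g x| ≤ K) : Continuous fun f : Lp ℝ 2 (densityMeasure I ρ) =>
      ∫ x, g x * secondaryOperator I ρ μ hρ.moments hμ.moments f x ∂densityMeasure I ρ := by
  have h1 : MemLp (fun x => g x * (ρ x / μ x)) 2 (densityMeasure I μ) :=
    (memLp_div hred).of_le_mul (c := K) (hg.aestronglyMeasurable.mul (memLp_div hred).1)
      (.of_forall fun x => by
        rw [norm_mul]
        exact mul_le_mul_of_nonneg_right (hK x) (norm_nonneg _))
  have h2 : (fun f : Lp ℝ 2 (densityMeasure I ρ) =>
      ∫ x, g x * secondaryOperator I ρ μ hρ.moments hμ.moments f x ∂densityMeasure I ρ) =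
      fun f => inner ℝ (secondaryOperator I ρ μ hρ.moments hμ.moments f) h1.toLp := by
    ext f
    rw [integral_densityMeasure_eq hρ hμ hred, L2.inner_def]
    refine integral_congr_ae ?_
    filter_upwards [h1.coeFn_toLp] with x hx
    rw [hx]
    simp only [RCLike.inner_apply, conj_trivial]
    ring
  rw [h2]
  fun_prop

theorem integral_secondaryOperator (f : Lp ℝ 2 (densityMeasure I ρ)) :
    ∫ x, secondaryOperator I ρ μ hρ.moments hμ.moments f x ∂densityMeasure I ρ =
      ∫ x, f x * reducer (densityMeasure I ρ) x ∂densityMeasure I ρ := by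
  have hc := continuous_integral_secondaryOperator hρ hμ hred (g := fun _ => 1) (K := 1)
    measurable_const (by simp)
  simp only [one_mul] at hc
  refine hρ.dense.induction (P := fun f => _ = ∫ x, f x * _ ∂_) ?_
    (isClosed_eq hc (continuous_integral_mul hred.memLp)) f
  rintro _ ⟨p, rfl⟩
  rw [integral_congr_ae (coeFn_secondaryOperator_polyToLp hρ hμ hred p),
    integral_secondary_eq_integral_mul_reducer hred]
  refine integral_congr_ae ?_
  filter_upwards [coeFn_polyToLp hρ.moments p] with x hx
  rw [hx]

theorem integral_mul_secondary_of_contDiffOn {f g : ℝ → ℝ} (hf : ContDiffOn ℝ 1 f I)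
    (hf2 : MemLp f 2 (densityMeasure I ρ)) (hg : ContDiff ℝ 1 g) (hgc : HasCompactSupport g)
    (hgI : tsupport g ⊆ interior I) :
    Integrable (fun x => g x * secondary (densityMeasure I ρ) f x) (densityMeasure I ρ) ∧
    ∫ x, g x * secondary (densityMeasure I ρ) f x ∂densityMeasure I ρ =
      (∫ x, f x * (g x * reducer (densityMeasure I ρ) x) ∂densityMeasure I ρ) -
        ∫ x, f x * secondary (densityMeasure I ρ) g x ∂densityMeasure I ρ := by
  have := hρ.isProbabilityMeasure
  have hfg := contDiff_mul_of_tsupport_subset_interior hf hg hgI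
  have hfgc : HasCompactSupport fun t => f t * g t := hgc.mul_left
  obtain ⟨K, hK⟩ := ContDiff.lipschitzWith_of_hasCompactSupport hgc hg one_ne_zero
  obtain ⟨L, hL⟩ := ContDiff.lipschitzWith_of_hasCompactSupport hfgc hfg one_ne_zero
  have hfg2 : MemLp (fun t => f t * g t) 2 (densityMeasure I ρ) :=
    hfg.continuous.memLp_of_hasCompactSupport hfgc
  constructor
  · refine (integrable_quotient_mul hf2 hK hL).integral_prod_left.congr (.of_forall fun x => ?_)
    simp only [integral_mul_const]
    rw [mul_comm]
    rfl
  · rw [integral_mul_secondary hred.memLp hred.tendsto hf2 hK hL hfg2]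
    simp only [mul_assoc]

/-- The weak formula of `integral_mul_secondary_of_contDiffOn` holds for polynomials and passes to
the closure: `g φ` and the bounded function `T g` lie in `L²(ρ)`, so every term is continuous in
`f`. -/
theorem integral_mul_secondaryOperator {g : ℝ → ℝ} (hg : ContDiff ℝ 1 g)
    (hgc : HasCompactSupport g) (hgI : tsupport g ⊆ interior I)
    (f : Lp ℝ 2 (densityMeasure I ρ)) :
    ∫ x, g x * secondaryOperator I ρ μ hρ.moments hμ.moments f x ∂densityMeasure I ρ =
      (∫ x, f x * (g x * reducer (densityMeasure I ρ) x) ∂densityMeasure I ρ) -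
        ∫ x, f x * secondary (densityMeasure I ρ) g x ∂densityMeasure I ρ := by
  have := hρ.isProbabilityMeasure
  obtain ⟨K, hK⟩ := ContDiff.lipschitzWith_of_hasCompactSupport hgc hg one_ne_zero
  obtain ⟨C, hC⟩ := hgc.exists_bound_of_continuous hg.continuous
  have h1 : MemLp (fun x => g x * reducer (densityMeasure I ρ) x) 2 (densityMeasure I ρ) :=
    hred.memLp.of_le_mul (c := C)
      (hg.continuous.measurable.aestronglyMeasurable.mul hred.memLp.1)
      (.of_forall fun x => by
        rw [norm_mul]
        exact mul_le_mul_of_nonneg_right (hC x) (norm_nonneg _))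
  have h2 : MemLp (secondary (densityMeasure I ρ) g) 2 (densityMeasure I ρ) :=
    MemLp.of_bound (measurable_secondary hg.continuous.measurable).aestronglyMeasurable K
      (.of_forall fun x => abs_secondary_le hK x)
  refine hρ.dense.induction (P := fun f => _ = (∫ x, f x * _ ∂_) - ∫ x, f x * _ ∂_) ?_
    (isClosed_eq (continuous_integral_secondaryOperator hρ hμ hred hg.continuous.measurable hC)
      ((continuous_integral_mul h1).sub (continuous_integral_mul h2))) f
  rintro _ ⟨p, rfl⟩
  have h3 := (integral_mul_secondary_of_contDiffOn hρ hμ hred (f := fun t => p.eval t)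
    (by simpa using (p.contDiff_aeval (𝕜 := ℝ) 1).contDiffOn) (memLp_eval hρ.moments p) hg hgc hgI).2
  convert h3 using 1
  · refine integral_congr_ae ?_
    filter_upwards [coeFn_secondaryOperator_polyToLp hρ hμ hred p] with x hx
    rw [hx]
  · congr 1
    all_goals
      refine integral_congr_ae ?_
      filter_upwards [coeFn_polyToLp hρ.moments p] with x hx
      rw [hx]

theorem locallyIntegrableOn_secondary {f : ℝ → ℝ} (hf : ContDiffOn ℝ 1 f I)
    (hf2 : MemLp f 2 (densityMeasure I ρ)) :
    LocallyIntegrableOn (secondary (densityMeasure I ρ) f) (interior I) (densityMeasure I ρ) := by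
  intro x hx
  obtain ⟨δ, hδ, hball⟩ := Metric.nhds_basis_closedBall.mem_iff.1 (isOpen_interior.mem_nhds hx)
  -- A bump equal to `1` near `x` and supported in the interior: its product with `T f` is
  -- integrable, and near `x` it is `T f`.
  let b : ContDiffBump x := ⟨δ / 2, δ, by positivity, by linarith⟩
  have h1 := (integral_mul_secondary_of_contDiffOn hρ hμ hred hf hf2 (g := b) b.contDiff
    b.hasCompactSupport (by rw [b.tsupport_eq]; exact hball)).1
  refine ⟨Metric.closedBall x (δ / 2), mem_nhdsWithin_of_mem_nhds
    (Metric.closedBall_mem_nhds x (by positivity)), ?_⟩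
  refine h1.integrableOn.congr_fun (fun y hy => ?_) Metric.isClosed_closedBall.measurableSet
  simp only [b.one_of_mem_closedBall hy, one_mul]

/-- Both functions satisfy the same weak formula, so their difference integrates to `0` against
every test function in the interior of `I`, which carries the whole measure. -/
theorem secondary_ae_eq_secondaryOperator {f : ℝ → ℝ} (hf : ContDiffOn ℝ 1 f I)
    (hf2 : MemLp f 2 (densityMeasure I ρ)) :
    secondary (densityMeasure I ρ) f =ᵐ[densityMeasure I ρ]
      secondaryOperator I ρ μ hρ.moments hμ.moments hf2.toLp := by
  have hT := integrable_of_memLp_secondary hρ hμ hred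
    (Lp.memLp (secondaryOperator I ρ μ hρ.moments hμ.moments hf2.toLp))
  have h1 := isOpen_interior.ae_eq_zero_of_integral_contDiff_smul_eq_zero
    ((locallyIntegrableOn_secondary hρ hμ hred hf hf2).sub
      (hT.locallyIntegrable.locallyIntegrableOn _)) fun g hg hgc hgI => by
    have hg1 : ContDiff ℝ 1 g := hg.of_le (by exact_mod_cast le_top)
    obtain ⟨h2, h3⟩ := integral_mul_secondary_of_contDiffOn hρ hμ hred hf hf2 hg1 hgc hgI
    have h4 := integral_mul_secondaryOperator hρ hμ hred hg1 hgc hgI hf2.toLp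
    obtain ⟨C, hC⟩ := hgc.exists_bound_of_continuous hg1.continuous
    have h5 := hT.bdd_mul hg1.continuous.measurable.aestronglyMeasurable (.of_forall hC)
    simp only [Pi.sub_apply, smul_eq_mul, mul_sub]
    rw [integral_sub h2 h5, h3, h4, sub_eq_zero]
    congr 1
    all_goals
      refine integral_congr_ae ?_
      filter_upwards [hf2.coeFn_toLp] with x hx
      rw [hx]
  filter_upwards [h1, ae_mem_interior_densityMeasure hρ.ordConnected ρ] with x hx hxI
  exact sub_eq_zero.1 (hx hxI)

end Density

/-! ### Parseval's identity for the orthonormal polynomials -/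

theorem IsOrthonormalPolynomials.orthonormal_polyToLp {ν : Measure ℝ} {P : ℕ → ℝ[X]}
    (hν : HasMoments ν) (hP : IsOrthonormalPolynomials ν P) :
    Orthonormal ℝ fun n => polyToLp ν hν (P n) := by
  refine orthonormal_iff_ite.2 fun m n => ?_
  rw [inner_polyToLp, ← hP.orthonormal m n]
  refine integral_congr_ae ?_
  filter_upwards [coeFn_polyToLp hν (P m)] with x hx
  rw [hx]

/-- One polynomial of each degree spans all polynomials, and these are dense, so the `P n` form a
Hilbert basis and Parseval applies. -/
theorem IsOrthonormalPolynomials.hasSum_coeff_mul_coeff {ν : Measure ℝ} {P : ℕ → ℝ[X]}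
    (hν : HasMoments ν) (hd : DenseRange (polyToLp ν hν)) (hP : IsOrthonormalPolynomials ν P)
    {f g : ℝ → ℝ} (hf : MemLp f 2 ν) (hg : MemLp g 2 ν) :
    HasSum (fun n => coeff ν (P n) f * coeff ν (P n) g) (∫ x, f x * g x ∂ν) := by
  have hspan : Submodule.span ℝ (Set.range P) = ⊤ := by
    let S : Polynomial.Sequence ℝ := ⟨P, hP.degree⟩
    exact S.span fun i => (leadingCoeff_ne_zero.2 (S.ne_zero i)).isUnit
  have hdense : ⊤ ≤ (Submodule.span ℝ
      (Set.range fun n => polyToLp ν hν (P n))).topologicalClosure := by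
    have h1 : Submodule.span ℝ (Set.range fun n => polyToLp ν hν (P n)) =
        LinearMap.range (polyToLp ν hν) := by
      rw [show (fun n => polyToLp ν hν (P n)) = polyToLp ν hν ∘ P from rfl, Set.range_comp,
        ← Submodule.map_span, hspan, Submodule.map_top]
    rw [h1]
    intro x _
    exact hd x
  let b := HilbertBasis.mk (hP.orthonormal_polyToLp hν) hdense
  have hb : ∀ {f : ℝ → ℝ} (hf : MemLp f 2 ν) n, inner ℝ hf.toLp (b n) = coeff ν (P n) f := by
    intro f hf n
    rw [HilbertBasis.coe_mk, inner_polyToLp, coeff]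
    refine integral_congr_ae ?_
    filter_upwards [hf.coeFn_toLp] with x hx
    rw [hx]
  have h2 := b.hasSum_inner_mul_inner hf.toLp hg.toLp
  have h3 : ∀ n, inner ℝ (b n) hg.toLp = coeff ν (P n) g := fun n => by
    rw [real_inner_comm, hb hg]
  simp only [hb hf, h3] at h2
  have h4 : inner ℝ hf.toLp hg.toLp = ∫ x, f x * g x ∂ν := by
    rw [L2.inner_def]
    refine integral_congr_ae ?_
    filter_upwards [hf.coeFn_toLp, hg.coeFn_toLp] with x hx hx'
    rw [hx, hx']
    simp [mul_comm]
  rwa [h4] at h2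

theorem IsOrthonormalPolynomials.exists_eq_C {ν : Measure ℝ} {P : ℕ → ℝ[X]}
    (hP : IsOrthonormalPolynomials ν P) : ∃ a, P 0 = C a :=
  ⟨_, eq_C_of_degree_le_zero (hP.degree 0).le⟩

theorem IsOrthonormalPolynomials.integral_eq_zero {ν : Measure ℝ} {P : ℕ → ℝ[X]}
    (hP : IsOrthonormalPolynomials ν P) {n : ℕ} (hn : n ≠ 0) : ∫ t, (P n).eval t ∂ν = 0 := by
  obtain ⟨a, ha⟩ := hP.exists_eq_C
  have ha0 : a ≠ 0 := by
    rintro rfl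
    have := hP.degree 0
    simp [ha] at this
  have h1 := hP.orthonormal 0 n
  rw [if_neg hn.symm, ha] at h1
  simpa [integral_const_mul, ha0] using h1

end SecondaryMeasure

/-! ### Assembly of the two statements -/

theorem mainTheorem8 (I : Set ℝ) (ρ μ : ℝ → ℝ)
    (hρ : IsAdmissibleDensity I ρ) (hμ : IsSecondaryDensity I ρ μ)
    (hred : IsReducible I ρ μ hρ.moments hμ.moments)
    (P : ℕ → ℝ[X]) (hP : IsOrthonormalPolynomials (densityMeasure I ρ) P) :
    (∀ n : ℕ,
      coeff (densityMeasure I ρ) (P n) (reducer (densityMeasure I ρ)) =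
          ∫ x, secondaryOperator I ρ μ hρ.moments hμ.moments hred.memLp.toLp x *
            secondary (densityMeasure I ρ) (fun t => (P n).eval t) x ∂densityMeasure I μ ∧
      coeff (densityMeasure I ρ) (P n) (reducer (densityMeasure I ρ)) =
          ∫ x, ρ x / μ x *
            secondary (densityMeasure I ρ) (fun t => (P n).eval t) x ∂densityMeasure I μ ∧
      coeff (densityMeasure I ρ) (P n) (reducer (densityMeasure I ρ)) =
          ∫ x, secondary (densityMeasure I ρ) (fun t => (P n).eval t) x ∂densityMeasure I ρ) ∧
    (∀ f : ℝ → ℝ, ContDiffOn ℝ 1 f I → MemLp f 2 (densityMeasure I ρ) →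
      (∀ x ∈ I, Integrable (fun y => (f y - f x) / (y - x)) (densityMeasure I ρ)) ∧
      Integrable (fun x => ∫ y, (f y - f x) / (y - x) ∂densityMeasure I ρ)
        (densityMeasure I ρ) ∧
      HasSum (fun n : ℕ =>
          coeff (densityMeasure I ρ) (P (n + 1)) (reducer (densityMeasure I ρ)) *
            coeff (densityMeasure I ρ) (P (n + 1)) f)
        (∫ x, (∫ y, (f y - f x) / (y - x) ∂densityMeasure I ρ) ∂densityMeasure I ρ)) := by
  have h3 : ∀ n, coeff (densityMeasure I ρ) (P n) (reducer (densityMeasure I ρ)) =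
      ∫ x, secondary (densityMeasure I ρ) (fun t => (P n).eval t) x ∂densityMeasure I ρ := by
    intro n
    rw [integral_secondary_eq_integral_mul_reducer hred, SecondaryMeasure.coeff]
    simp only [mul_comm]
  have h0 : coeff (densityMeasure I ρ) (P 0) (reducer (densityMeasure I ρ)) = 0 := by
    obtain ⟨a, ha⟩ := hP.exists_eq_C
    rw [h3, ha]
    simp only [secondary_C, integral_zero]
  refine ⟨fun n => ⟨?_, ?_, h3 n⟩, fun f hf hf2 => ⟨fun x hx =>
    integrable_quotient_of_contDiffOn hρ hf hf2 hx, ?_, ?_⟩⟩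
  -- The index `0` is separate: `P 0` has nonzero mean, but there both sides vanish because `Q_0 =
  -- 0`.
  · rcases eq_or_ne n 0 with rfl | hn
    · obtain ⟨a, ha⟩ := hP.exists_eq_C
      rw [h0, ha]
      simp only [secondary_C, mul_zero, integral_zero]
    · rw [integral_secondaryOperator_mul_secondary hρ hμ, hP.integral_eq_zero hn, mul_zero,
        sub_zero, SecondaryMeasure.coeff]
      refine integral_congr_ae ?_
      filter_upwards [hred.memLp.coeFn_toLp] with x hx
      rw [hx]
  · rw [h3, integral_densityMeasure_eq hρ hμ hred]
  · exact (integrable_of_memLp_secondary hρ hμ hred (Lp.memLp _)).congr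
      (secondary_ae_eq_secondaryOperator hρ hμ hred hf hf2).symm
  · have h4 := hP.hasSum_coeff_mul_coeff hρ.moments hρ.dense hred.memLp hf2
    have h5 : ∫ x, (∫ y, (f y - f x) / (y - x) ∂densityMeasure I ρ) ∂densityMeasure I ρ =
        ∫ x, reducer (densityMeasure I ρ) x * f x ∂densityMeasure I ρ := by
      refine (integral_congr_ae (secondary_ae_eq_secondaryOperator hρ hμ hred hf hf2)).trans ?_
      rw [integral_secondaryOperator hρ hμ hred]
      refine integral_congr_ae ?_
      filter_upwards [hf2.coeFn_toLp] with x hx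
      rw [hx, mul_comm]
    rw [h5]
    -- The term of index `0` is zero, so the shifted series keeps the full Parseval sum. `HasSum` is
    -- unconditional, which for real series is absolute convergence.
    refine (hasSum_nat_add_iff (f := fun n =>
      coeff (densityMeasure I ρ) (P n) (reducer (densityMeasure I ρ)) *
        coeff (densityMeasure I ρ) (P n) f) 1).2 ?_
    simpa [h0] using h4
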